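/- **Setting.** Surfaces are smooth, closed, connected and oriented. A *generalized pseudo-Anosov homeomorphism* of a surface $S$ is an orientation-preserving homeomorphism $f:S\to S$ together with two $f$-invariant transverse measured foliations $(\mathcal F^s,\mu^s)$, $(\mathcal F^u,\mu^u)$, with common $k$-prong singularities ($1$-prongs, or spines, are allowed), and a number $\lambda>1$ such that $\mu^s(f(J))=\lambda\,\mu^s(J)$ for every unstable arc $J$ and $\mu^u(f(I))=\lambda^{-1}\mu^u(I)$ for every stable arc $I$. $\mathrm{Sing}(f)$ is the set of singularities of the foliations; if there are none, $\mathrm{Sing}(f)$ is a non-empty finite $f$-invariant set of periodic points, chosen once and for all as part of the data. Intervals and arcs in leaves are compact, embedded and not reduced to a point. **Rectangles.** For $r\subset S$ open, connected and non-empty and $x\in r$, let $I_x$, $J_x$ be the closures of the components through $x$ of the intersection with $r$ of the stable, resp. unstable, leaf of $x$. If for all $x,y\in r$ the sets $I_x$, $J_y$ are arcs and $I_x\cap J_y$ is a single point, lying in $r$, then $R=\overline r$ is a *rectangle* with interior $\overset{o}{R}=r$. A *parametrization* of $R$ is a continuous surjection $\rho:[0,1]^2\to R$ that restricts to an orientation-preserving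 homeomorphism $(0,1)^2\to\overset{o}{R}$ and maps horizontal (vertical) segments of the square injectively into stable (unstable) leaves; their images are the horizontal and vertical leaves of $R$. The image of the upward direction is a *vertical direction* of $R$ (there are two choices); the image of the rightward direction is then the horizontal direction. A rectangle $H\subset R$ is a *horizontal (vertical) sub-rectangle* of $R$ if for every $x\in\overset{o}{H}$ the components through $x$ of the intersections of the stable (unstable) leaf of $x$ with $\overset{o}{H}$ and with $\overset{o}{R}$ coincide. **Geometric types.** A *geometric Markov partition* of $f$ is a labelled family $\mathcal R=\{R_i\}_{i=1}^n$ of rectangles, each with a chosen vertical direction, with pairwise disjoint interiors and union $S$, such that the closure of every component of $\overset{o}{R_i}\cap f^{-1}(\overset{o}{R_j})$ is a horizontal sub-rectangle of $R_i$ and the closure of every component of $f(\overset{o}{R_i})\cap\overset{o}{R_j}$ is a vertical sub-rectangle of $R_j$. Let $H^i_1,\dots,H^i_{h_i}$ be the former in $R_i$ (for all $j$), from bottom to top, and $V^k_1,\dots,V^k_{v_k}$ the latter in $R_k$ (for all $i$), from left to right. The *geometric type* of $\mathcal R$ is $T(f,\mathcal R)=(n,\{(h_i,v_i)\}_{i=1}^n,\rho,\epsilon)$,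 where $\rho(i,j)=(k,l)$ if and only if $f(H^i_j)=V^k_l$, and then $\epsilon(i,j)=1$ if $f$ maps the vertical direction of $R_i$ on $H^i_j$ to the vertical direction of $R_k$ on $V^k_l$, and $\epsilon(i,j)=-1$ otherwise. **Graphs.** Let $\delta$ be a family of arcs in stable leaves. Its regular part is $\bigcup\delta$ minus all endpoints of its arcs. A *regular $u$-rail* of $\delta$ is an unstable arc with endpoints in the regular part and interior disjoint from $\bigcup\delta$. An *extreme $u$-rail* of $\delta$ is an unstable arc $J$ with at least one endpoint outside the regular part, for which there is a rectangle $R$ with an injective parametrization, with its horizontal sides contained in $\bigcup\delta$, such that $J$ is one of its two vertical sides and every other vertical leaf of $R$ is a regular $u$-rail of $\delta$. Extreme $s$-rails of a family of unstable arcs are defined symmetrically. A family $\delta^s$ of stable arcs and a family $\delta^u$ of unstable arcs are *compatible* if all endpoints of arcs of each lie in the union of the other, the extreme $u$-rails of $\delta^s$ lie in $\bigcup\delta^u$ and the extreme $s$-rails of $\delta^u$ lie in $\bigcup\delta^s$. **Primitive Markov partitions.** A point $z\notin\mathrm{Sing}(f)$ is a *first intersection point* of $f$ if there are $p,q\in\mathrm{Sing}(f)$,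 a stable arc $[p,z]^s$ and an unstable arc $[q,z]^u$ with $(p,z]^s\cap(q,z]^u=\{z\}$. For such $z$ put $\mathcal J^u(z)=\bigcup_{i\ge 0}f^{-i}([q,z]^u)$. Let $\delta^s(z)$ be the family of all stable arcs with one endpoint in $\mathrm{Sing}(f)$, the other in $\mathcal J^u(z)$, and interior disjoint from $\mathcal J^u(z)$; let $\delta^u(z)$ be the family of all unstable arcs with one endpoint in $\mathrm{Sing}(f)$, the other in $\bigcup\delta^s(z)$, and interior disjoint from $\bigcup\delta^s(z)$. Let $n(z)$ be the least $N\in\mathbb N$ such that $\delta^s(z)$ and $f^n(\delta^u(z))$ are compatible for all $n\ge N$, and let $n(f)=\max\{n(z): z \text{ a first intersection point of } f\}$. Let $\mathcal R(z,m)$ be the family of the closures of the connected components of $S\setminus\bigl(\bigcup\delta^s(z)\cup\bigcup f^m(\delta^u(z))\bigr)$. For $m\ge n(f)$ let $\mathcal T(f,m)$ be the set of all geometric types $T(f,\mathcal R)$, where $\mathcal R$ is a geometric Markov partition of $f$ obtained from $\mathcal R(z,m)$, for some first intersection point $z$ of $f$, by a labelling of its rectangles and a choice of vertical directions. The elements of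 $\mathcal T(f,n(f))$ are the *canonical types* of $f$. **Statement.** Let $f:S_f\to S_f$ and $g:S_g\to S_g$ be generalized pseudo-Anosov homeomorphisms that are conjugate by an orientation-preserving homeomorphism $h:S_f\to S_g$, i.e. $h\circ f=g\circ h$. If the invariant foliations of $f$ have no singularities, assume moreover that $h(\mathrm{Sing}(f))=\mathrm{Sing}(g)$. Then $n(f)=n(g)$, and $\mathcal T(f,m)=\mathcal T(g,m)$ for all $m\ge n(f)=n(g)$. In particular their canonical types coincide: $\mathcal T(f,n(f))=\mathcal T(g,n(g))$. -/

import Mathlib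

open Set Filter Topology
open scoped Manifold ContDiff

noncomputable section

namespace PA

/-! ### Orientation and surfaces -/

/-- The `2π`-periodic loop `γ` avoids `0` and winds exactly once, counterclockwise, around `0`:
it has a continuous logarithm which increases by `2πi` over one period. -/
def WindsOnce (γ : ℝ → ℂ) : Prop :=
  ∃ L : ℝ → ℂ, Continuous L ∧ (∀ t, Complex.exp (L t) = γ t) ∧
    L (2 * Real.pi) = L 0 + 2 * Real.pi * Complex.I

/-- The planar map `ψ` (a homeomorphism near `z`) preserves orientation at `z`: images of small
counterclockwise circles around `z` wind once counterclockwise around `ψ z`. -/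
def PreservesOrientationAt (ψ : ℂ → ℂ) (z : ℂ) : Prop :=
  ∀ᶠ r : ℝ in 𝓝[>] 0,
    WindsOnce (fun t : ℝ => ψ (z + r * Complex.exp (t * Complex.I)) - ψ z)

/-- A smooth closed connected surface, oriented by its atlas (the plane is `ℂ`, regarded as a real
vector space with its standard orientation). -/
class OrientedSurface (S : Type*) [TopologicalSpace S] [ChartedSpace ℂ S] : Prop where
  compact : CompactSpace S
  hausdorff : T2Space S
  connected : ConnectedSpace S
  smooth : IsManifold 𝓘(ℝ, ℂ) ∞ S
  oriented : ∀ e ∈ atlas ℂ S, ∀ e' ∈ atlas ℂ S, ∀ z ∈ (e.symm.trans e').source,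
    PreservesOrientationAt (e' ∘ e.symm) z

/-- A homeomorphism between surfaces oriented by their atlases preserves orientation. -/
def OrientationPreserving {S S' : Type*} [TopologicalSpace S] [ChartedSpace ℂ S]
    [TopologicalSpace S'] [ChartedSpace ℂ S'] (h : S ≃ₜ S') : Prop :=
  ∀ x : S, PreservesOrientationAt
    (chartAt ℂ (h x) ∘ h ∘ (chartAt ℂ x).symm) (chartAt ℂ x x)

/-! ### Arcs and components -/

section Topological

variable {S : Type*} [TopologicalSpace S]

/-- `J` is a compact embedded interval, not reduced to a point, with endpoints `a` and `b`. -/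
def IsArc (a b : S) (J : Set S) : Prop :=
  ∃ γ : ℝ → S, ContinuousOn γ (Icc 0 1) ∧ InjOn γ (Icc 0 1) ∧ γ 0 = a ∧ γ 1 = b ∧
    γ '' Icc 0 1 = J

/-- The endpoints `∂J` of an arc. -/
def arcEnds (J : Set S) : Set S := {a | ∃ b, IsArc a b J}

/-- The connected components of a set `A`. -/
def components (A : Set S) : Set (Set S) := {C | ∃ x ∈ A, C = connectedComponentIn A x}

/-! ### Measured foliations with prong singularities -/

/-- `|Im z^{k/2}|`: its level sets are the leaves of the standard horizontal foliation with a
`k`-prong at `0`, and it is the coordinate measuring arcs transverse to that foliation.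
For `k = 2` it is `|Im z|`. -/
def horModel (k : ℕ) (z : ℂ) : ℝ := Real.sqrt ((‖z‖ ^ k - (z ^ k).re) / 2)

/-- `|Re z^{k/2}|`: the same for the standard vertical foliation with a `k`-prong at `0`. -/
def verModel (k : ℕ) (z : ℂ) : ℝ := Real.sqrt ((‖z‖ ^ k + (z ^ k).re) / 2)

/-- A decomposition of `S` into leaves, and a candidate transverse measure `meas`
(only its values on transverse arcs are relevant). -/
structure PreFoliation (S : Type*) where
  sameLeaf : Setoid S
  meas : Set S → ENNReal

/-- The leaf through `x`. -/
def PreFoliation.leaf (F : PreFoliation S) (x : S) : Set S := {y | F.sameLeaf x y}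

/-- In the chart `φ`, the foliation `F` and its transverse measure are given by the model function
`m`: plaques (the path components of the traces of leaves on the domain) are the path components
of level sets of `m`, and the measure of an arc on which `m` is monotone is the variation of `m`. -/
structure PreFoliation.IsModelled (F : PreFoliation S) (φ : OpenPartialHomeomorph S ℂ)
    (m : ℂ → ℝ) : Prop where
  plaque : ∀ y ∈ φ.source,
    φ '' pathComponentIn (F.leaf y ∩ φ.source) y =
      pathComponentIn ({w | m w = m (φ y)} ∩ φ.target) (φ y)
  measure : ∀ (a b : S) (J : Set S), IsArc a b J → J ⊆ φ.source → InjOn (m ∘ φ) J →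
    F.meas J = ENNReal.ofReal |m (φ b) - m (φ a)|

/-- `φ` is a chart centred at `x` whose image is a round disc. -/
def IsDiscChart (φ : OpenPartialHomeomorph S ℂ) (x : S) : Prop :=
  x ∈ φ.source ∧ φ x = 0 ∧ ∃ r > 0, φ.target = Metric.ball 0 r

/-- A measured foliation with prong singularities (spines, i.e. `1`-prongs, are allowed): every
point is a `k`-prong for some `k ≥ 1`, a regular point being a `2`-prong. -/
structure PreFoliation.IsMeasuredFoliation (F : PreFoliation S) : Prop where
  leaf_connected : ∀ x, IsPathConnected (F.leaf x)
  local_model : ∀ x, ∃ k ≥ 1, ∃ φ : OpenPartialHomeomorph S ℂ,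
    IsDiscChart φ x ∧ F.IsModelled φ (horModel k)
  meas_union : ∀ (a b c : S) (J K : Set S), IsArc a b J → IsArc b c K → J ∩ K = {b} →
    F.meas (J ∪ K) = F.meas J + F.meas K

/-- `x` is a common `k`-prong of `F` and `G`, near which they are the horizontal and the vertical
foliation of the standard model. -/
def IsCommonProng (F G : PreFoliation S) (x : S) (k : ℕ) : Prop :=
  ∃ φ : OpenPartialHomeomorph S ℂ, IsDiscChart φ x ∧ F.IsModelled φ (horModel k) ∧
    G.IsModelled φ (verModel k)

/-- Transversality of measured foliations: they have common singularities, and locally they are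
the horizontal and the vertical foliation of the standard model. -/
def AreTransverse (F G : PreFoliation S) : Prop := ∀ x, ∃ k ≥ 1, IsCommonProng F G x k

/-- The common singularities of a pair of transverse foliations. -/
def prongSing (F G : PreFoliation S) : Set S := {x | ∃ k ≥ 1, k ≠ 2 ∧ IsCommonProng F G x k}

end Topological

/-! ### Generalized pseudo-Anosov homeomorphisms -/

/-- A generalized pseudo-Anosov homeomorphism of an oriented surface `S`. The measure of the stable
foliation measures unstable arcs, which are expanded. -/
structure PseudoAnosov (S : Type*) [TopologicalSpace S] [ChartedSpace ℂ S] where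
  toHomeo : S ≃ₜ S
  orientation : OrientationPreserving toHomeo
  /-- the stable foliation `(𝓕ˢ, μˢ)` -/
  stable : PreFoliation S
  /-- the unstable foliation `(𝓕ᵘ, μᵘ)` -/
  unstable : PreFoliation S
  stable_foliation : stable.IsMeasuredFoliation
  unstable_foliation : unstable.IsMeasuredFoliation
  transverse : AreTransverse stable unstable
  image_stable : ∀ x, toHomeo '' stable.leaf x = stable.leaf (toHomeo x)
  image_unstable : ∀ x, toHomeo '' unstable.leaf x = unstable.leaf (toHomeo x)
  /-- the stretch factor `λ` -/
  stretch : ℝ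
  one_lt_stretch : 1 < stretch
  expand : ∀ (a b : S) (J : Set S), IsArc a b J → J ⊆ unstable.leaf a →
    stable.meas (toHomeo '' J) = ENNReal.ofReal stretch * stable.meas J
  contract : ∀ (a b : S) (I : Set S), IsArc a b I → I ⊆ stable.leaf a →
    unstable.meas (toHomeo '' I) = ENNReal.ofReal (1 / stretch) * unstable.meas I
  /-- the set `Sing(f)` -/
  sing : Set S
  sing_eq : (prongSing stable unstable).Nonempty → sing = prongSing stable unstable
  /-- if the foliations have no singularities, `Sing(f)` is a chosen finite invariant set of
  periodic points -/
  sing_marked : prongSing stable unstable = ∅ →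
    sing.Finite ∧ sing.Nonempty ∧ toHomeo '' sing = sing ∧
      sing ⊆ Function.periodicPts toHomeo

/-! ### Rectangles -/

section Rectangles

variable {S : Type*} [TopologicalSpace S]

/-- The component through `x` of the trace on `r` of the leaf of `F` through `x`. -/
def leafIn (F : PreFoliation S) (r : Set S) (x : S) : Set S := pathComponentIn (F.leaf x ∩ r) x

/-- `r` is open, connected, non-empty and trivially bi-foliated by `A` and `B`. The closure of `r`
is a rectangle, and `r` is the interior of that rectangle. -/
structure TriviallyBifoliated (A B : PreFoliation S) (r : Set S) : Prop where
  isOpen : IsOpen r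
  connected : IsConnected r
  arc_left : ∀ x ∈ r, ∃ a b, IsArc a b (closure (leafIn A r x))
  arc_right : ∀ x ∈ r, ∃ a b, IsArc a b (closure (leafIn B r x))
  inter : ∀ x ∈ r, ∀ y ∈ r, ∃ z ∈ r, closure (leafIn A r x) ∩ closure (leafIn B r y) = {z}

/-- The rectangle `closure C` is a sub-rectangle of the rectangle `closure r` crossing it completely
in the direction of `A` (so it is a horizontal sub-rectangle if `A` is the stable foliation and `B`
the unstable one, and a vertical sub-rectangle if the roles are exchanged). -/
def IsSubrectangle (A B : PreFoliation S) (C r : Set S) : Prop :=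
  TriviallyBifoliated A B C ∧ closure C ⊆ closure r ∧ ∀ x ∈ C, leafIn A C x = leafIn A r x

/-- The closed unit square `[0,1] × [0,1]`. -/
def closedSquare : Set ℂ := Icc 0 1 ×ℂ Icc 0 1

/-- The open unit square `(0,1) × (0,1)`. -/
def openSquare : Set ℂ := Ioo 0 1 ×ℂ Ioo 0 1

/-- `ρ` is a parametrization of the rectangle `closure r` with interior `r`, whose horizontal
leaves lie in leaves of `A` and whose vertical leaves lie in leaves of `B`. -/
structure IsParametrization [ChartedSpace ℂ S] (A B : PreFoliation S) (r : Set S) (ρ : ℂ → S) :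
    Prop where
  bifoliated : TriviallyBifoliated A B r
  continuousOn : ContinuousOn ρ closedSquare
  image_closed : ρ '' closedSquare = closure r
  image_open : ρ '' openSquare = r
  injOn_open : InjOn ρ openSquare
  open_map : ∀ U ⊆ openSquare, IsOpen U → IsOpen (ρ '' U)
  orientation : ∀ z ∈ openSquare, PreservesOrientationAt (chartAt ℂ (ρ z) ∘ ρ) z
  horizontal : ∀ z ∈ closedSquare, ∀ w ∈ closedSquare, z.im = w.im → ρ w ∈ A.leaf (ρ z)
  horizontal_inj : ∀ z ∈ closedSquare, ∀ w ∈ closedSquare, z.im = w.im → ρ z = ρ w → z = w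
  vertical : ∀ z ∈ closedSquare, ∀ w ∈ closedSquare, z.re = w.re → ρ w ∈ B.leaf (ρ z)
  vertical_inj : ∀ z ∈ closedSquare, ∀ w ∈ closedSquare, z.re = w.re → ρ z = ρ w → z = w

/-! ### Graphs, rails and compatibility -/

/-- The graph generated by `𝒥`: all segments of leaves of `A` with one endpoint in `P`, the other
in `𝒥`, and interior disjoint from `𝒥`. -/
def generatedGraph (A : PreFoliation S) (P 𝒥 : Set S) : Set (Set S) :=
  {I | ∃ p ∈ P, ∃ x ∈ 𝒥, IsArc p x I ∧ I ⊆ A.leaf p ∧ (I \ {p, x}) ∩ 𝒥 = ∅}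

/-- The set of all endpoints of the intervals of `δ`. -/
def graphEnds (δ : Set (Set S)) : Set S := {x | ∃ I ∈ δ, x ∈ arcEnds I}

/-- The regular part of `δ`. -/
def regularPart (δ : Set (Set S)) : Set S := ⋃₀ δ \ graphEnds δ

/-- `J` is a regular rail of `δ`, for a graph `δ` of arcs tangent to the other foliation: an interval
in a leaf of `B` with endpoints in the regular part of `δ` and interior disjoint from `δ`. -/
def IsRegularRail (B : PreFoliation S) (δ : Set (Set S)) (J : Set S) : Prop :=
  ∃ a b, IsArc a b J ∧ J ⊆ B.leaf a ∧ a ∈ regularPart δ ∧ b ∈ regularPart δ ∧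
    (J \ {a, b}) ∩ ⋃₀ δ = ∅

/-- The vertical leaf at abscissa `s` of a parametrized rectangle. -/
def verticalLeaf (ρ : ℂ → S) (s : ℝ) : Set S := ρ '' {z ∈ closedSquare | z.re = s}

/-- The extreme rails (intervals in leaves of `B`) of a graph `δ` of arcs in leaves of `A`. For `A`
stable and `B` unstable these are the extreme `u`-rails of `δ`; with the roles exchanged, the
extreme `s`-rails. -/
def extremeRails [ChartedSpace ℂ S] (A B : PreFoliation S) (δ : Set (Set S)) : Set (Set S) :=
  {J | (∃ a b, IsArc a b J ∧ J ⊆ B.leaf a ∧ a ∉ regularPart δ) ∧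
    ∃ (r : Set S) (ρ : ℂ → S), IsParametrization A B r ρ ∧ InjOn ρ closedSquare ∧
      ρ '' {z ∈ closedSquare | z.im = 0 ∨ z.im = 1} ⊆ ⋃₀ δ ∧
      ∃ s₀ : ℝ, (s₀ = 0 ∨ s₀ = 1) ∧ J = verticalLeaf ρ s₀ ∧
        ∀ s ∈ Icc (0 : ℝ) 1, s ≠ s₀ → IsRegularRail B δ (verticalLeaf ρ s)}

end Rectangles

namespace PseudoAnosov

variable {S : Type*} [TopologicalSpace S] [ChartedSpace ℂ S] (f : PseudoAnosov S)

/-- Compatibility of an `s`-graph and a `u`-graph. -/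
def Compatible (δs δu : Set (Set S)) : Prop :=
  graphEnds δs ⊆ ⋃₀ δu ∧ graphEnds δu ⊆ ⋃₀ δs ∧
    (∀ J ∈ extremeRails f.stable f.unstable δs, J ⊆ ⋃₀ δu) ∧
    (∀ I ∈ extremeRails f.unstable f.stable δu, I ⊆ ⋃₀ δs)

/-- `z` is a first intersection point of `f`: it is not in `Sing(f)`, and for some `p` and `q` in
`Sing(f)` one has `(p, z]ˢ ∩ (q, z]ᵘ = {z}`. -/
def IsFirstIntersection (z : S) : Prop :=
  z ∉ f.sing ∧ ∃ p ∈ f.sing, ∃ q ∈ f.sing, ∃ I J : Set S,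
    IsArc p z I ∧ I ⊆ f.stable.leaf p ∧ IsArc q z J ∧ J ⊆ f.unstable.leaf q ∧
    (I \ {p}) ∩ (J \ {q}) = {z}

/-- The primitive segment `[q, z]ᵘ`, for `z` on an unstable separatrix of `q ∈ Sing(f)` (there is
exactly one unstable arc from a point of `Sing(f)` to `z`). -/
def primitiveSegment (z : S) : Set S :=
  ⋃₀ {J | ∃ q ∈ f.sing, IsArc q z J ∧ J ⊆ f.unstable.leaf q}

/-- The union of all backward iterates of the primitive segment. -/
def segmentOrbit (z : S) : Set S := {x | ∃ i : ℕ, f.toHomeo^[i] x ∈ f.primitiveSegment z}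

/-- The `s`-graph `δˢ(z)`. -/
def sGraph (z : S) : Set (Set S) := generatedGraph f.stable f.sing (f.segmentOrbit z)

/-- The `u`-graph `δᵘ(z)`. -/
def uGraph (z : S) : Set (Set S) := generatedGraph f.unstable f.sing (⋃₀ f.sGraph z)

/-- The `u`-graph `fⁿ(δᵘ(z))`. -/
def uGraphIter (z : S) (n : ℕ) : Set (Set S) := (fun J => f.toHomeo^[n] '' J) '' f.uGraph z

/-- The compatibility coefficient `n(z)`: the least `N` such that `δˢ(z)` and `fⁿ(δᵘ(z))` are
compatible for all `n ≥ N`. -/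
def compatibilityCoefficient (z : S) : ℕ :=
  sInf {N | ∀ n ≥ N, f.Compatible (f.sGraph z) (f.uGraphIter z n)}

/-- The compatibility order `n(f)`: the maximum of `n(z)` over first intersection points `z`. -/
def compatibilityOrder : ℕ :=
  sSup {N | ∃ z, f.IsFirstIntersection z ∧ N = f.compatibilityCoefficient z}

/-- The interiors of the rectangles of `𝓡(z, n)`: the components of the complement of
`⋃ δˢ(z) ∪ ⋃ fⁿ(δᵘ(z))`. -/
def primitiveInteriors (z : S) (n : ℕ) : Set (Set S) :=
  components (⋃₀ f.sGraph z ∪ ⋃₀ f.uGraphIter z n)ᶜ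

end PseudoAnosov

/-! ### Geometric Markov partitions and geometric types -/

/-- A geometric Markov partition of `f` with `n` labelled rectangles `closure (int i)`. The vertical
(horizontal) direction of a rectangle is the image under its orientation-preserving parametrization
of the upward (rightward) direction of the square. -/
structure GeometricMarkovPartition {S : Type*} [TopologicalSpace S] [ChartedSpace ℂ S]
    (f : PseudoAnosov S) (n : ℕ) where
  int : Fin n → Set S
  param : Fin n → ℂ → S
  isParam : ∀ i, IsParametrization f.stable f.unstable (int i) (param i)
  cover : ⋃ i, closure (int i) = univ
  disjoint : ∀ i j, i ≠ j → Disjoint (int i) (int j)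
  horizontal : ∀ i j, ∀ C ∈ components (int i ∩ f.toHomeo ⁻¹' int j),
    IsSubrectangle f.stable f.unstable C (int i)
  vertical : ∀ i j, ∀ C ∈ components (f.toHomeo '' int i ∩ int j),
    IsSubrectangle f.unstable f.stable C (int j)

/-- An abstract geometric type `(n, {(hᵢ, vᵢ)}, ρ, ε)`; labels start at `0`. -/
structure GeometricType where
  n : ℕ
  h : Fin n → ℕ
  v : Fin n → ℕ
  perm : (Σ i, Fin (h i)) ≃ (Σ k, Fin (v k))
  sign : (Σ i, Fin (h i)) → ℤˣ

namespace GeometricMarkovPartition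

variable {S : Type*} [TopologicalSpace S] [ChartedSpace ℂ S] {f : PseudoAnosov S} {n : ℕ}
  (R : GeometricMarkovPartition f n)

/-- Interiors of the horizontal sub-rectangles of `(f, R)` in the `i`-th rectangle. -/
def horizontals (i : Fin n) : Set (Set S) :=
  components (R.int i ∩ ⋃ j, f.toHomeo ⁻¹' R.int j)

/-- Interiors of the vertical sub-rectangles of `(f, R)` in the `k`-th rectangle. -/
def verticals (k : Fin n) : Set (Set S) :=
  components (R.int k ∩ ⋃ i, f.toHomeo '' R.int i)

/-- `H` lists the horizontal sub-rectangles in the `i`-th rectangle once each, from bottom to top. -/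
def IsHorizontalLabelling (i : Fin n) {a : ℕ} (H : Fin a → Set S) : Prop :=
  range H = R.horizontals i ∧ ∀ j j', j < j' → ∀ z ∈ openSquare, ∀ w ∈ openSquare,
    R.param i z ∈ H j → R.param i w ∈ H j' → z.im < w.im

/-- `V` lists the vertical sub-rectangles in the `k`-th rectangle once each, from left to right. -/
def IsVerticalLabelling (k : Fin n) {b : ℕ} (V : Fin b → Set S) : Prop :=
  range V = R.verticals k ∧ ∀ l l', l < l' → ∀ z ∈ openSquare, ∀ w ∈ openSquare,
    R.param k z ∈ V l → R.param k w ∈ V l' → z.re < w.re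

/-- `f` carries the vertical direction of the `i`-th rectangle, on its sub-rectangle `H`, to the
vertical direction of the `k`-th rectangle. -/
def PreservesVertical (i k : Fin n) (H : Set S) : Prop :=
  ∀ z ∈ openSquare, ∀ w ∈ openSquare, R.param i z ∈ H → R.param i w ∈ H →
    z.re = w.re → z.im < w.im →
    ∀ z' ∈ openSquare, ∀ w' ∈ openSquare, R.param k z' = f.toHomeo (R.param i z) →
      R.param k w' = f.toHomeo (R.param i w) → z'.im < w'.im

end GeometricMarkovPartition

/-- `T` is the geometric type of the geometric Markov partition `R` of `f`. -/
def HasGeometricType {S : Type*} [TopologicalSpace S] [ChartedSpace ℂ S] {f : PseudoAnosov S}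
    (T : GeometricType) (R : GeometricMarkovPartition f T.n) : Prop :=
  ∃ (H : ∀ i, Fin (T.h i) → Set S) (V : ∀ k, Fin (T.v k) → Set S),
    (∀ i, R.IsHorizontalLabelling i (H i)) ∧ (∀ k, R.IsVerticalLabelling k (V k)) ∧
    (∀ i j, f.toHomeo '' H i j = V (T.perm ⟨i, j⟩).1 (T.perm ⟨i, j⟩).2) ∧
    (∀ i j, T.sign ⟨i, j⟩ = 1 ↔ R.PreservesVertical i (T.perm ⟨i, j⟩).1 (H i j))

namespace PseudoAnosov

variable {S : Type*} [TopologicalSpace S] [ChartedSpace ℂ S] (f : PseudoAnosov S)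

/-- The set `𝒯(f, m)` of primitive geometric types of order `m`: the geometric types of the
partitions `𝓡(z, m)`, for `z` a first intersection point, with any labelling of the rectangles and
any choice of vertical directions. -/
def primitiveTypes (m : ℕ) : Set GeometricType :=
  {T | ∃ z, f.IsFirstIntersection z ∧ ∃ R : GeometricMarkovPartition f T.n,
    Function.Injective R.int ∧ range R.int = f.primitiveInteriors z m ∧ HasGeometricType T R}

/-- The canonical geometric types `𝒯(f, n(f))`. -/
def canonicalTypes : Set GeometricType := f.primitiveTypes f.compatibilityOrder

end PseudoAnosov

end PA

end

/-!
The definitions of the order `n(f)` and of the types `𝒯(f, m)` mention, besides the topology and the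
orientation of the surface, only the dynamics, the leaves of the two foliations and `Sing(f)`; the
transverse measures do not enter. So it suffices to show that an orientation preserving conjugacy
`h` carries the leaves of `f` to those of `g` and `Sing(f)` to `Sing(g)`
(`PA.isConjugacy_of_conj`). All the objects are then transported along `h`
(`PA.IsConjugacy.compatibilityOrder`, `PA.IsConjugacy.primitiveTypes`); the orientation of
parametrizations is transported by the invariance of winding numbers under homotopy
(`PA.OrientationPreserving.comp_param`), which also shows that `h⁻¹` preserves orientation, so that
every inclusion obtained for `h` holds for `h⁻¹` too.

The leaves have to be described by the topological dynamics. Two points lie on the same stable leaf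
if and only if they are joined by a path which is locally uniformly contracted by the iterates of `f`
(`PA.IsHyperbolic.mem_leaf_iff`). Arcs in stable leaves are contracted because their measures tend
to zero and arcs of small measure are small (`PA.exists_meas_lt_imp_mem`). Conversely, let a path
not be locally contained in a leaf. In a prong chart it crosses an interval of stable leaves inside
one sector, and an unstable arc `J` on the axis of the sector crosses the same leaves. The points of
`J` are joined to the path by stable arcs of bounded measure, which are contracted; so if the path
were contracted, the iterates of `J` would become small. But their measures grow exponentially,
whereas small unstable arcs have bounded measure (`PA.exists_meas_le_of_small`). The unstable leaves
are the stable leaves of the inverse, which is why the argument is carried out for the structure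
`PA.IsHyperbolic`, symmetric in this sense.

As to `Sing(f)`: a homeomorphism which maps leaves to leaves maps the rays of the singular leaf of a
`k`-prong injectively to rays of the image prong (`PA.prong_le_prong`), so it preserves the number
of prongs.
-/

noncomputable section
namespace PA

/-! ### Winding numbers and orientation -/

/-- The loop `γ` (parametrized by `[0, 2π]`) avoids `0` and has winding number `n` around `0`. -/
def HasWinding (γ : ℝ → ℂ) (n : ℤ) : Prop :=
  ∃ L : ℝ → ℂ, Continuous L ∧ (∀ t, Complex.exp (L t) = γ t) ∧
    L (2 * Real.pi) = L 0 + n * (2 * Real.pi * Complex.I)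

theorem windsOnce_iff {γ : ℝ → ℂ} : WindsOnce γ ↔ HasWinding γ 1 := by
  simp [WindsOnce, HasWinding]

theorem exists_continuous_log {X : Type*} [TopologicalSpace X] [SimplyConnectedSpace X]
    [LocallyPathConnectedSpace X] {g : X → ℂ} (hg : Continuous g) (h0 : ∀ x, g x ≠ 0) :
    ∃ L : X → ℂ, Continuous L ∧ ∀ x, Complex.exp (L x) = g x := by
  obtain ⟨x₀⟩ : Nonempty X := inferInstance
  obtain ⟨F, ⟨-, hF⟩, -⟩ := Complex.isCoveringMapOn_exp.existsUnique_continuousMap_lifts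
    (⟨g, hg⟩ : C(X, ℂ)) (a₀ := x₀) (Complex.exp_log (h0 x₀)) (fun a => h0 a)
  exact ⟨F, F.continuous, fun x => congrFun hF x⟩

theorem exists_eq_add_of_exp_eq {X : Type*} [TopologicalSpace X] [PreconnectedSpace X] [Nonempty X]
    {L M : X → ℂ} (hL : Continuous L) (hM : Continuous M)
    (h : ∀ x, Complex.exp (L x) = Complex.exp (M x)) :
    ∃ n : ℤ, ∀ x, L x = M x + n * (2 * Real.pi * Complex.I) := by
  obtain ⟨a⟩ : Nonempty X := inferInstance
  obtain ⟨n, hn⟩ := Complex.exp_eq_exp_iff_exists_int.1 (h a)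
  refine ⟨n, fun x => ?_⟩
  have := Complex.isCoveringMap_exp.eq_of_comp_eq (g₁ := L)
    (g₂ := fun x => M x + n * (2 * Real.pi * Complex.I)) hL (by fun_prop) ?_ a hn
  · exact congrFun this x
  · funext x
    apply Subtype.ext
    simp [h, Complex.exp_add, Complex.exp_int_mul_two_pi_mul_I]

/-- The winding number is unchanged in a free homotopy of loops avoiding `0`. -/
theorem HasWinding.homotopy {G : ℝ × ℝ → ℂ} (hG : Continuous G) (h0 : ∀ x, G x ≠ 0)
    (hper : ∀ s, G (s, 2 * Real.pi) = G (s, 0)) {n : ℤ} (hn : HasWinding (fun t => G (0, t)) n) :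
    HasWinding (fun t => G (1, t)) n := by
  obtain ⟨M, hM, hexp⟩ := exists_continuous_log hG h0
  obtain ⟨L, hL, hLexp, hLn⟩ := hn
  obtain ⟨a, ha⟩ := exists_eq_add_of_exp_eq (L := fun t : ℝ => M (0, t)) (M := L) (by fun_prop) hL
    (fun t => by rw [hexp, hLexp])
  obtain ⟨b, hb⟩ := exists_eq_add_of_exp_eq (L := fun s : ℝ => M (s, 2 * Real.pi))
    (M := fun s : ℝ => M (s, 0)) (by fun_prop) (by fun_prop) (fun s => by rw [hexp, hexp, hper])
  refine ⟨fun t => M (1, t), by fun_prop, fun t => hexp _, ?_⟩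
  have h1 := ha 0
  have h2 := ha (2 * Real.pi)
  have h3 := hb 0
  have h4 := hb 1
  simp only at h1 h2 h3 h4 ⊢
  rw [h4]
  linear_combination h2 - h1 - h3 + hLn

theorem HasWinding.unique {γ : ℝ → ℂ} {m n : ℤ} (hm : HasWinding γ m) (hn : HasWinding γ n) :
    m = n := by
  obtain ⟨L, hL, hLe, hL'⟩ := hm
  obtain ⟨M, hM, hMe, hM'⟩ := hn
  obtain ⟨a, ha⟩ := exists_eq_add_of_exp_eq hL hM (fun t => by rw [hLe, hMe])
  have h1 := ha 0
  have h2 := ha (2 * Real.pi)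
  have h3 : (m : ℂ) * (2 * Real.pi * Complex.I) = n * (2 * Real.pi * Complex.I) := by
    linear_combination -hL' + hM' + h2 - h1
  exact_mod_cast mul_right_cancel₀ Complex.two_pi_I_ne_zero h3

theorem exists_hasWinding {γ : ℝ → ℂ} (hγ : Continuous γ) (h0 : ∀ t, γ t ≠ 0)
    (hper : γ (2 * Real.pi) = γ 0) : ∃ n, HasWinding γ n := by
  obtain ⟨L, hL, hLe⟩ := exists_continuous_log hγ h0
  have : Complex.exp (L (2 * Real.pi)) = Complex.exp (L 0) := by rw [hLe, hLe, hper]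
  obtain ⟨n, hn⟩ := Complex.exp_eq_exp_iff_exists_int.1 this
  exact ⟨n, L, hL, hLe, hn⟩

theorem exp_add_two_pi_mul_I (t : ℝ) :
    Complex.exp (((t + 2 * Real.pi : ℝ) : ℂ) * Complex.I) = Complex.exp (t * Complex.I) := by
  rw [Complex.ofReal_add, add_mul, Complex.exp_add]
  simp [Complex.exp_two_pi_mul_I]

/-- A multiply traversed small circle: its image under an orientation preserving map has the
corresponding winding number. -/
theorem WindsOnce.pow_circle {φ : ℂ → ℂ} {p : ℂ} {r : ℝ}
    (h : WindsOnce (fun t : ℝ => φ (p + r * Complex.exp (t * Complex.I)) - φ p)) (n : ℤ) :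
    HasWinding (fun t : ℝ => φ (p + r * Complex.exp ((n * t : ℝ) * Complex.I)) - φ p) n := by
  obtain ⟨L, hL, hLe, hL'⟩ := h
  obtain ⟨a, ha⟩ := exists_eq_add_of_exp_eq (L := fun t : ℝ => L (t + 2 * Real.pi)) (M := L)
    (by fun_prop) hL (fun t => by simp only [hLe, exp_add_two_pi_mul_I])
  have ha1 : (a : ℂ) * (2 * Real.pi * Complex.I) = 2 * Real.pi * Complex.I := by
    have := ha 0
    simp only [zero_add] at this
    linear_combination hL' - this
  have key : ∀ n : ℤ, L (n * (2 * Real.pi)) = L 0 + n * (2 * Real.pi * Complex.I) := by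
    intro n
    induction n using Int.induction_on with
    | zero => simp
    | succ i ih =>
      have := ha ((i : ℤ) * (2 * Real.pi))
      simp only [ih, ha1] at this
      push_cast at this ⊢
      rw [add_mul, one_mul, this]; ring
    | pred i ih =>
      have := ha ((-i - 1 : ℤ) * (2 * Real.pi))
      simp only [ha1] at this
      rw [show ((-i - 1 : ℤ) : ℝ) * (2 * Real.pi) + 2 * Real.pi = (-i : ℤ) * (2 * Real.pi) by
        push_cast; ring, ih] at this
      push_cast at this ⊢
      linear_combination -this
  refine ⟨fun t => L (n * t), by fun_prop, fun t => hLe _, ?_⟩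
  simp [key]

/-- A map which preserves orientation at `p` preserves winding numbers of small loops. -/
theorem HasWinding.map {φ : ℂ → ℂ} {p : ℂ} {R : ℝ}
    (hφc : ContinuousOn φ (Metric.ball p R))
    (hφ : ∀ r, 0 < r → r < R →
      WindsOnce (fun t : ℝ => φ (p + r * Complex.exp (t * Complex.I)) - φ p))
    {γ : ℝ → ℂ} {n : ℤ} (hγ : HasWinding γ n) (hγR : ∀ t, ‖γ t‖ < R) :
    HasWinding (fun t => φ (p + γ t) - φ p) n := by
  obtain ⟨L, hL, hLe, hL'⟩ := hγ
  have hR : 0 < R := (norm_nonneg _).trans_lt (hγR 0)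
  -- `φ` takes the value `φ p` only at `p`, since every small circle is mapped to a loop avoiding it
  have hne : ∀ w : ℂ, w ≠ 0 → ‖w‖ < R → φ (p + w) - φ p ≠ 0 := by
    intro w hw hwR
    obtain ⟨L, -, hLe, -⟩ := hφ ‖w‖ (norm_pos_iff.2 hw) hwR
    have := hLe w.arg
    simp only [Complex.norm_mul_exp_arg_mul_I] at this
    exact this ▸ Complex.exp_ne_zero _
  let σ : ℝ → ℝ := fun s => max 0 (min 1 s)
  have hσ : Continuous σ := by fun_prop
  have hσ0 : ∀ s, 0 ≤ σ s := fun s => le_max_left _ _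
  have hσ1 : ∀ s, σ s ≤ 1 := fun s => max_le zero_le_one (min_le_left _ _)
  -- interpolating linearly between logarithms deforms the `n`-fold circle of radius `R / 2` into `γ`
  -- inside the punctured disc
  let E : ℝ × ℝ → ℂ := fun x =>
    (1 - σ x.1 : ℝ) * ((Real.log (R / 2) : ℝ) + (n * x.2 : ℝ) * Complex.I) + (σ x.1 : ℝ) * L x.2
  have hE : Continuous E := by fun_prop
  have hEn : ∀ x, ‖Complex.exp (E x)‖ < R := by
    intro x
    rw [Complex.norm_exp, ← Real.exp_log hR, Real.exp_lt_exp]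
    have h1 : (L x.2).re < Real.log R := by
      rw [← Real.exp_lt_exp, Real.exp_log hR, ← Complex.norm_exp, hLe]; exact hγR _
    have h2 : Real.log (R / 2) < Real.log R := Real.log_lt_log (by positivity) (by linarith)
    have h3 : (E x).re = (1 - σ x.1) * Real.log (R / 2) + σ x.1 * (L x.2).re := by
      simp [E]
    rw [h3]
    rcases (hσ0 x.1).eq_or_lt with h | h
    · rw [← h]; linarith
    · nlinarith [hσ1 x.1]
  have key := HasWinding.homotopy (n := n) (G := fun x => φ (p + Complex.exp (E x)) - φ p) ?_
    (fun x => hne _ (Complex.exp_ne_zero _) (hEn x)) ?_ ?_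
  · convert key using 4 with t
    simp [E, σ, hLe]
  · refine Continuous.sub ?_ continuous_const
    exact hφc.comp_continuous (by fun_prop) (fun x => by simpa using hEn x)
  · intro s
    have : E (s, 2 * Real.pi) = E (s, 0) + n * (2 * Real.pi * Complex.I) := by
      simp only [E, hL']; push_cast; ring
    simp only [this, Complex.exp_add, Complex.exp_int_mul_two_pi_mul_I, mul_one]
  · convert (hφ (R / 2) (by positivity) (by linarith)).pow_circle n using 4 with t
    have : Complex.exp (Real.log (R / 2)) = ((R / 2 : ℝ) : ℂ) := by
      rw [← Complex.ofReal_exp, Real.exp_log (by positivity)]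
    simp only [E, σ]
    simp [Complex.exp_add, this]

theorem norm_circle (r t : ℝ) (hr : 0 < r) : ‖(r : ℂ) * Complex.exp (t * Complex.I)‖ = r := by
  rw [norm_mul, Complex.norm_exp_ofReal_mul_I, mul_one, Complex.norm_of_nonneg hr.le]

/-- A radius below which the circles around a point are mapped as orientation preservation demands,
and on whose disc the map is continuous. -/
theorem PreservesOrientationAt.exists_radius {φ : ℂ → ℂ} {p : ℂ} (h : PreservesOrientationAt φ p)
    (hc : ∀ᶠ w in 𝓝 p, ContinuousAt φ w) :
    ∃ R > 0, ContinuousOn φ (Metric.ball p R) ∧ ∀ r, 0 < r → r < R →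
      WindsOnce (fun t : ℝ => φ (p + r * Complex.exp (t * Complex.I)) - φ p) := by
  obtain ⟨R₁, hR₁, h₁⟩ := mem_nhdsGT_iff_exists_Ioo_subset.1 h
  obtain ⟨R₂, hR₂, h₂⟩ := Metric.eventually_nhds_iff_ball.1 hc
  refine ⟨min R₁ R₂, lt_min hR₁ hR₂, fun w hw => ?_, fun r hr hrR => ?_⟩
  · exact (h₂ w (Metric.ball_subset_ball (min_le_right _ _) hw)).continuousWithinAt
  · exact h₁ ⟨hr, hrR.trans_le (min_le_left _ _)⟩

theorem PreservesOrientationAt.congr {φ ψ : ℂ → ℂ} {p : ℂ} (h : PreservesOrientationAt φ p)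
    (e : φ =ᶠ[𝓝 p] ψ) : PreservesOrientationAt ψ p := by
  obtain ⟨R, hR, h₁⟩ := Metric.eventually_nhds_iff_ball.1 e
  have : Ioo 0 R ∈ 𝓝[>] (0 : ℝ) := Ioo_mem_nhdsGT hR
  filter_upwards [h, this] with r hr hrR
  convert hr using 3 with t
  · rw [h₁]; simp [abs_of_pos hrR.1, hrR.2]
  · rw [h₁]; simpa using hR

theorem eventually_circle_lt {ψ : ℂ → ℂ} {z : ℂ} (hc : ContinuousAt ψ z) {R : ℝ} (hR : 0 < R) :
    ∀ᶠ r : ℝ in 𝓝[>] 0, ∀ t : ℝ, ‖ψ (z + r * Complex.exp (t * Complex.I)) - ψ z‖ < R := by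
  obtain ⟨δ, hδ, h⟩ := Metric.continuousAt_iff.1 hc R hR
  filter_upwards [Ioo_mem_nhdsGT hδ] with r hr t
  rw [← dist_eq_norm]
  apply h
  rw [dist_eq_norm, add_sub_cancel_left, norm_circle _ _ hr.1]
  exact hr.2

theorem PreservesOrientationAt.comp {φ ψ : ℂ → ℂ} {z : ℂ} (hφ : PreservesOrientationAt φ (ψ z))
    (hφc : ∀ᶠ w in 𝓝 (ψ z), ContinuousAt φ w) (hψ : PreservesOrientationAt ψ z)
    (hψc : ContinuousAt ψ z) : PreservesOrientationAt (φ ∘ ψ) z := by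
  obtain ⟨R, hR, hc, hR'⟩ := hφ.exists_radius hφc
  filter_upwards [hψ, eventually_circle_lt hψc hR] with r hr hrR
  rw [windsOnce_iff] at hr ⊢
  simpa using hr.map hc hR' hrR

/-- The local inverse of an orientation preserving map preserves orientation. -/
theorem PreservesOrientationAt.inverse {ψ η : ℂ → ℂ} {z : ℂ} (hψ : PreservesOrientationAt ψ z)
    (hψc : ∀ᶠ w in 𝓝 z, ContinuousAt ψ w) (hηc : ∀ᶠ w in 𝓝 (ψ z), ContinuousAt η w)
    (hη : η (ψ z) = z) (hinv : ∀ᶠ w in 𝓝 (ψ z), ψ (η w) = w) :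
    PreservesOrientationAt η (ψ z) := by
  obtain ⟨R, hR, hc, hR'⟩ := hψ.exists_radius hψc
  obtain ⟨δ, hδ, h⟩ := Metric.eventually_nhds_iff_ball.1 (hηc.and hinv)
  filter_upwards [eventually_circle_lt hηc.self_of_nhds hR, Ioo_mem_nhdsGT hδ] with r hr hrδ
  have hmem : ∀ t : ℝ, ψ z + r * Complex.exp (t * Complex.I) ∈ Metric.ball (ψ z) δ := by
    intro t
    rw [Metric.mem_ball, dist_eq_norm, add_sub_cancel_left, norm_circle _ _ hrδ.1]
    exact hrδ.2
  have hr0 : (r : ℂ) ≠ 0 := by exact_mod_cast hrδ.1.ne'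
  have hex : ∃ n, HasWinding
      (fun t : ℝ => η (ψ z + r * Complex.exp (t * Complex.I)) - η (ψ z)) n := by
    refine exists_hasWinding ?_ ?_ ?_
    · refine Continuous.sub ?_ continuous_const
      rw [continuous_iff_continuousAt]
      intro t
      exact (h _ (hmem t)).1.comp (f := fun t : ℝ => ψ z + r * Complex.exp (t * Complex.I))
        (by fun_prop)
    · intro t ht
      have := (h _ (hmem t)).2
      rw [sub_eq_zero.1 ht, hη] at this
      exact mul_ne_zero hr0 (Complex.exp_ne_zero _) (left_eq_add.1 this)
    · have := exp_add_two_pi_mul_I 0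
      rw [zero_add] at this
      simp only [this]
  obtain ⟨n, hn⟩ := hex
  have h1 := hn.map hc hR' (fun t => by simpa [hη] using hr t)
  have h2 : HasWinding (fun t : ℝ => ψ z + r * Complex.exp (t * Complex.I) - ψ z) n := by
    convert h1 using 3 with t
    rw [hη, add_sub_cancel, (h _ (hmem t)).2]
  have h3 : HasWinding (fun t : ℝ => ψ z + r * Complex.exp (t * Complex.I) - ψ z) 1 := by
    refine ⟨fun t => Complex.log r + t * Complex.I, by fun_prop, fun t => ?_, ?_⟩
    · rw [Complex.exp_add, Complex.exp_log hr0]; ring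
    · push_cast; ring
  rw [windsOnce_iff]
  exact h2.unique h3 ▸ hn

section
variable {S S' : Type*} [TopologicalSpace S] [ChartedSpace ℂ S] [TopologicalSpace S']

theorem eventually_continuousAt_chart_comp (x : S) (ρ : ℂ → S) {z : ℂ} (hz : ρ z = x)
    (hρ : ∀ᶠ w in 𝓝 z, ContinuousAt ρ w) :
    ∀ᶠ w in 𝓝 z, ContinuousAt (chartAt ℂ x ∘ ρ) w := by
  have hs : (chartAt ℂ x).source ∈ 𝓝 (ρ z) := hz ▸ chart_source_mem_nhds ℂ x
  filter_upwards [hρ, hρ.self_of_nhds.preimage_mem_nhds hs] with w hw hw'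
  exact ((chartAt ℂ x).continuousAt hw').comp hw

theorem eventually_continuousAt_homeo_chart_symm (h : S ≃ₜ S') (x : S) :
    ∀ᶠ w in 𝓝 (chartAt ℂ x x), ContinuousAt (h ∘ (chartAt ℂ x).symm) w := by
  filter_upwards [chart_target_mem_nhds ℂ x] with w hw
  exact h.continuous.continuousAt.comp ((chartAt ℂ x).continuousAt_symm hw)

variable [ChartedSpace ℂ S']

/-- An orientation preserving homeomorphism carries positively oriented local parametrizations to
positively oriented local parametrizations. -/
theorem OrientationPreserving.comp_param {h : S ≃ₜ S'} (hh : OrientationPreserving h) {ρ : ℂ → S}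
    {z : ℂ} (hρ : ContinuousAt ρ z)
    (ho : PreservesOrientationAt (chartAt ℂ (ρ z) ∘ ρ) z) :
    PreservesOrientationAt (chartAt ℂ (h (ρ z)) ∘ (h ∘ ρ)) z := by
  have key := PreservesOrientationAt.comp (ψ := chartAt ℂ (ρ z) ∘ ρ) (z := z) (hh (ρ z)) ?_ ho ?_
  · refine key.congr ?_
    filter_upwards [hρ.preimage_mem_nhds (chart_source_mem_nhds ℂ (ρ z))] with w hw
    simp [(chartAt ℂ (ρ z)).left_inv hw]
  · exact eventually_continuousAt_chart_comp _ _ (by simp)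
      (eventually_continuousAt_homeo_chart_symm h (ρ z))
  · exact ((chartAt ℂ (ρ z)).continuousAt (mem_chart_source ℂ _)).comp hρ

theorem OrientationPreserving.symm {h : S ≃ₜ S'} (hh : OrientationPreserving h) :
    OrientationPreserving h.symm := by
  intro y
  obtain ⟨x, rfl⟩ := h.surjective y
  rw [h.symm_apply_apply]
  have e : (chartAt ℂ (h x) ∘ h ∘ (chartAt ℂ x).symm) (chartAt ℂ x x) = chartAt ℂ (h x) (h x) := by
    simp
  have key := (hh x).inverse (η := chartAt ℂ x ∘ h.symm ∘ (chartAt ℂ (h x)).symm)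
    (eventually_continuousAt_chart_comp _ _ (by simp)
      (eventually_continuousAt_homeo_chart_symm h x)) ?_ ?_ ?_
  · rwa [e] at key
  · rw [e]
    exact eventually_continuousAt_chart_comp _ _ (by simp)
      (eventually_continuousAt_homeo_chart_symm h.symm (h x))
  · simp
  · rw [e]
    have hc := (eventually_continuousAt_homeo_chart_symm h.symm (h x)).self_of_nhds
    filter_upwards [chart_target_mem_nhds ℂ (h x), hc.preimage_mem_nhds
      (show (chartAt ℂ x).source ∈ _ by simpa using chart_source_mem_nhds ℂ x)] with w hw hw'
    have hw' : h.symm ((chartAt ℂ (h x)).symm w) ∈ (chartAt ℂ x).source := hw'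
    simp [(chartAt ℂ x).left_inv hw', (chartAt ℂ (h x)).right_inv hw]

end

/-! ### The standard model of a prong -/

section Model

variable {k : ℕ} {z w : ℂ}

theorem horModel_nonneg : 0 ≤ horModel k z := Real.sqrt_nonneg _

theorem verModel_nonneg : 0 ≤ verModel k z := Real.sqrt_nonneg _

theorem re_pow_le_norm_pow (k : ℕ) (z : ℂ) : |(z ^ k).re| ≤ ‖z‖ ^ k := by
  rw [← norm_pow]; exact Complex.abs_re_le_norm _

theorem horModel_sq : horModel k z ^ 2 = (‖z‖ ^ k - (z ^ k).re) / 2 :=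
  Real.sq_sqrt (by linarith [(abs_le.1 (re_pow_le_norm_pow k z)).2])

theorem verModel_sq : verModel k z ^ 2 = (‖z‖ ^ k + (z ^ k).re) / 2 :=
  Real.sq_sqrt (by linarith [(abs_le.1 (re_pow_le_norm_pow k z)).1])

theorem horModel_sq_add_verModel_sq : horModel k z ^ 2 + verModel k z ^ 2 = ‖z‖ ^ k := by
  rw [horModel_sq, verModel_sq]; ring

@[fun_prop]
theorem continuous_horModel : Continuous (horModel k) := by unfold horModel; fun_prop

@[fun_prop]
theorem continuous_verModel : Continuous (verModel k) := by unfold verModel; fun_prop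

theorem horModel_le : horModel k z ≤ Real.sqrt (‖z‖ ^ k) :=
  Real.le_sqrt_of_sq_le (by nlinarith [horModel_sq_add_verModel_sq (k := k) (z := z)])

theorem verModel_le : verModel k z ≤ Real.sqrt (‖z‖ ^ k) :=
  Real.le_sqrt_of_sq_le (by nlinarith [horModel_sq_add_verModel_sq (k := k) (z := z)])

@[simp]
theorem horModel_zero (hk : 1 ≤ k) : horModel k 0 = 0 := by
  have : k ≠ 0 := by omega
  simp [horModel, this]

@[simp]
theorem verModel_zero (hk : 1 ≤ k) : verModel k 0 = 0 := by
  have : k ≠ 0 := by omega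
  simp [verModel, this]

theorem eq_zero_of_models_eq_zero (hh : horModel k z = 0) (hv : verModel k z = 0) : z = 0 := by
  have := horModel_sq_add_verModel_sq (k := k) (z := z)
  rw [hh, hv] at this
  exact norm_eq_zero.1 (eq_zero_of_pow_eq_zero (n := k) (by simpa using this.symm))

/-- If `ζ` is a value of `z^{k/2}`, the models are `|Im ζ|` and `|Re ζ|`. -/
theorem horModel_of_sq {ζ : ℂ} (h : z ^ k = ζ ^ 2) : horModel k z = |ζ.im| := by
  rw [← Real.sqrt_sq_eq_abs, horModel, ← norm_pow, h, norm_pow]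
  congr 1
  rw [← Complex.normSq_eq_norm_sq, Complex.normSq_apply]
  simp [pow_two]

theorem verModel_of_sq {ζ : ℂ} (h : z ^ k = ζ ^ 2) : verModel k z = |ζ.re| := by
  rw [← Real.sqrt_sq_eq_abs, verModel, ← norm_pow, h, norm_pow]
  congr 1
  rw [← Complex.normSq_eq_norm_sq, Complex.normSq_apply]
  simp [pow_two]

theorem norm_eq_one_of_pow {ξ : ℂ} (hk : 1 ≤ k) (hξ : ‖ξ ^ k‖ = 1) : ‖ξ‖ = 1 := by
  rw [norm_pow] at hξ
  exact (pow_eq_one_iff_of_nonneg (norm_nonneg _) (by omega)).1 hξ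

/-- Rotation by a `k`-th root of `-1` exchanges the two model foliations. -/
theorem horModel_rotate {ξ : ℂ} (hk : 1 ≤ k) (hξ : ξ ^ k = -1) :
    horModel k (ξ * z) = verModel k z := by
  have h1 : ‖ξ‖ = 1 := norm_eq_one_of_pow hk (by simp [hξ])
  simp [horModel, verModel, mul_pow, hξ, h1]

theorem verModel_rotate {ξ : ℂ} (hk : 1 ≤ k) (hξ : ξ ^ k = -1) :
    verModel k (ξ * z) = horModel k z := by
  have h1 : ‖ξ‖ = 1 := norm_eq_one_of_pow hk (by simp [hξ])
  simp [horModel, verModel, mul_pow, hξ, h1, sub_eq_add_neg]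

theorem exists_pow_eq_neg_one (hk : 1 ≤ k) : ∃ ξ : ℂ, ξ ^ k = -1 :=
  IsAlgClosed.exists_pow_nat_eq _ (by omega)

theorem horModel_smul (τ : ℝ) (hτ : 0 ≤ τ) :
    horModel k (τ * z) = Real.sqrt (τ ^ k) * horModel k z := by
  rw [horModel, horModel, ← Real.sqrt_mul (by positivity)]
  congr 1
  rw [mul_pow, norm_mul, mul_pow, Complex.norm_of_nonneg hτ, ← Complex.ofReal_pow,
    Complex.re_ofReal_mul]
  ring

theorem verModel_smul (τ : ℝ) (hτ : 0 ≤ τ) :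
    verModel k (τ * z) = Real.sqrt (τ ^ k) * verModel k z := by
  rw [verModel, verModel, ← Real.sqrt_mul (by positivity)]
  congr 1
  rw [mul_pow, norm_mul, mul_pow, Complex.norm_of_nonneg hτ, ← Complex.ofReal_pow,
    Complex.re_ofReal_mul]
  ring

/-! ### Branches of the model coordinate -/

/-- The value of `z^{k/2}` with positive real part, when `verModel k z ≠ 0`. -/
def modelCoord (k : ℕ) (z : ℂ) : ℂ := ⟨verModel k z, (z ^ k).im / (2 * verModel k z)⟩

theorem modelCoord_sq (h : 0 < verModel k z) : z ^ k = modelCoord k z ^ 2 := by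
  have h1 := verModel_sq (k := k) (z := z)
  have h2 := horModel_sq (k := k) (z := z)
  have h3 : (z ^ k).re ^ 2 + (z ^ k).im ^ 2 = (‖z‖ ^ k) ^ 2 := by
    rw [← norm_pow, ← Complex.normSq_eq_norm_sq, Complex.normSq_apply]; ring
  apply Complex.ext
  · simp only [modelCoord, pow_two, Complex.mul_re]
    have h4 : (z ^ k).im ^ 2 = 4 * verModel k z ^ 2 * horModel k z ^ 2 := by
      rw [h1, h2]; linear_combination h3
    have h5 : (z ^ k).im / (2 * verModel k z) * ((z ^ k).im / (2 * verModel k z)) =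
        horModel k z ^ 2 := by
      rw [div_mul_div_comm, ← pow_two, h4]; field_simp; ring
    rw [h5, ← pow_two, h1, h2]; ring
  · simp only [modelCoord, pow_two, Complex.mul_im]
    field_simp
    ring

theorem abs_im_modelCoord (h : 0 < verModel k z) : |(modelCoord k z).im| = horModel k z :=
  (horModel_of_sq (modelCoord_sq h)).symm

/-- The branch `ζ ↦ ζ^{2/k}` on the right half-plane, inverse to the model coordinate on a
sector. -/
def sectorMap (k : ℕ) (ζ : ℂ) : ℂ := ζ ^ (2 / k : ℂ)

theorem sectorMap_pow (hk : 1 ≤ k) (ζ : ℂ) : sectorMap k ζ ^ k = ζ ^ 2 := by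
  have : (k : ℂ) ≠ 0 := by exact_mod_cast (by omega : k ≠ 0)
  rw [sectorMap, ← Complex.cpow_mul_nat, div_mul_cancel₀ _ this]
  exact_mod_cast Complex.cpow_natCast ζ 2

theorem continuousAt_sectorMap {ζ : ℂ} (h : 0 < ζ.re) : ContinuousAt (sectorMap k) ζ :=
  continuousAt_id.cpow continuousAt_const (Or.inl h)

theorem IsPreconnected.eq_of_finite_image {X Y : Type*} [TopologicalSpace X] [TopologicalSpace Y]
    [T1Space Y] {T : Set X} (hT : IsPreconnected T) {f : X → Y} (hf : ContinuousOn f T)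
    {F : Set Y} (hF : F.Finite) (hm : MapsTo f T F) {x y : X} (hx : x ∈ T) (hy : y ∈ T) :
    f x = f y := by
  exact hT.constant_of_mapsTo hF.isDiscrete hf hm hx hy

theorem finite_pow_eq (hk : 1 ≤ k) (a : ℂ) : {z : ℂ | z ^ k = a}.Finite := by
  refine (Polynomial.nthRoots k a).toFinset.finite_toSet.subset fun z hz => ?_
  simpa [Polynomial.mem_nthRoots (show 0 < k by omega)] using hz

/-- Where `verModel` is positive, a connected family of points stays in one sector, on which the
point is a function of its model coordinate. -/
theorem exists_eq_sectorMap {X : Type*} [TopologicalSpace X] {T : Set X} (hT : IsPreconnected T)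
    {w : X → ℂ} (hw : ContinuousOn w T) (hk : 1 ≤ k) (hpos : ∀ t ∈ T, 0 < verModel k (w t)) :
    ∃ ξ : ℂ, ξ ^ k = 1 ∧ ∀ t ∈ T, w t = ξ * sectorMap k (modelCoord k (w t)) := by
  rcases T.eq_empty_or_nonempty with rfl | ⟨t₀, ht₀⟩
  · exact ⟨1, by simp⟩
  have hne : ∀ t ∈ T, sectorMap k (modelCoord k (w t)) ≠ 0 := by
    intro t ht h0
    have h1 := sectorMap_pow hk (modelCoord k (w t))
    rw [h0, zero_pow (by omega)] at h1
    have h2 : modelCoord k (w t) = 0 := eq_zero_of_pow_eq_zero h1.symm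
    have h3 := congrArg Complex.re h2
    simp only [modelCoord, Complex.zero_re] at h3
    exact (hpos t ht).ne' h3
  have hcc : ContinuousOn (fun t => modelCoord k (w t)) T := by
    have h1 : ContinuousOn (fun t => verModel k (w t)) T := continuous_verModel.comp_continuousOn hw
    have h2 : ContinuousOn (fun t => (w t ^ k).im / (2 * verModel k (w t))) T :=
      (Complex.continuous_im.comp_continuousOn (hw.pow k)).div (continuousOn_const.mul h1)
        (fun t ht => by have := hpos t ht; positivity)
    have : (fun t => modelCoord k (w t)) = fun t => ((verModel k (w t) : ℝ) : ℂ) +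
        (((w t ^ k).im / (2 * verModel k (w t)) : ℝ) : ℂ) * Complex.I := by
      funext t; exact Complex.mk_eq_add_mul_I _ _
    rw [this]
    exact (Complex.continuous_ofReal.comp_continuousOn h1).add
      ((Complex.continuous_ofReal.comp_continuousOn h2).mul continuousOn_const)
  have hsc : ContinuousOn (fun t => sectorMap k (modelCoord k (w t))) T := fun t ht =>
    ContinuousAt.comp_continuousWithinAt (g := sectorMap k)
      (continuousAt_sectorMap (by simpa [modelCoord] using hpos t ht)) (hcc t ht)
  have hroot : ∀ t ∈ T, (w t / sectorMap k (modelCoord k (w t))) ^ k = 1 := by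
    intro t ht
    rw [div_pow, div_eq_one_iff_eq (pow_ne_zero _ (hne t ht)), sectorMap_pow hk,
      modelCoord_sq (hpos t ht)]
  refine ⟨_, hroot t₀ ht₀, fun t ht => ?_⟩
  have := IsPreconnected.eq_of_finite_image hT
    (f := fun t => w t / sectorMap k (modelCoord k (w t))) (hw.div hsc hne) (finite_pow_eq hk 1)
    (fun t ht => hroot t ht) ht₀ ht
  rw [this, div_mul_cancel₀ _ (hne t ht)]

/-- On a leaf of the model, the transverse coordinate of the other model foliation is injective
away from its zeros. -/
theorem injOn_verModel {T : Set ℝ} (hT : IsPreconnected T) {w : ℝ → ℂ} (hw : ContinuousOn w T)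
    (hinj : InjOn w T) (hk : 1 ≤ k) (hpos : ∀ t ∈ T, 0 < verModel k (w t)) {c : ℝ}
    (hc : ∀ t ∈ T, horModel k (w t) = c) : InjOn (fun t => verModel k (w t)) T := by
  obtain ⟨ξ, -, hξ⟩ := exists_eq_sectorMap hT hw hk hpos
  intro s hs t ht hst
  apply hinj hs ht
  rw [hξ s hs, hξ t ht]
  congr 2
  apply Complex.ext
  · exact hst
  · refine IsPreconnected.eq_of_finite_image hT (f := fun t => (modelCoord k (w t)).im) ?_
      (F := {c, -c}) (by simp) (fun t ht => ?_) hs ht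
    · exact (Complex.continuous_im.comp_continuousOn (hw.pow k)).div
        (continuousOn_const.mul (continuous_verModel.comp_continuousOn hw))
        (fun t ht => by have := hpos t ht; simp [this.ne'])
    · have h1 := abs_im_modelCoord (hpos t ht)
      rw [hc t ht] at h1
      exact eq_or_eq_neg_of_abs_eq h1

theorem injOn_horModel {T : Set ℝ} (hT : IsPreconnected T) {w : ℝ → ℂ} (hw : ContinuousOn w T)
    (hinj : InjOn w T) (hk : 1 ≤ k) (hpos : ∀ t ∈ T, 0 < horModel k (w t)) {c : ℝ}
    (hc : ∀ t ∈ T, verModel k (w t) = c) : InjOn (fun t => horModel k (w t)) T := by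
  obtain ⟨ξ, hξ⟩ := exists_pow_eq_neg_one hk
  have h0 : ξ ≠ 0 := by rintro rfl; simp [show k ≠ 0 by omega] at hξ
  have := injOn_verModel hT (w := fun t => ξ * w t) (continuousOn_const.mul hw)
    (fun s hs t ht h => hinj hs ht (mul_left_cancel₀ h0 h)) hk (c := c)
    (fun t ht => by rw [verModel_rotate hk hξ]; exact hpos t ht)
    (fun t ht => by rw [horModel_rotate hk hξ]; exact hc t ht)
  simpa only [verModel_rotate hk hξ] using this

/-- A leaf of one model foliation meets the zero set of the other transverse coordinate at most
once. -/
theorem eq_of_horModel_eq_zero {T : Set ℝ} (hT : IsPreconnected T) {w : ℝ → ℂ}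
    (hw : ContinuousOn w T) (hinj : InjOn w T) (hk : 1 ≤ k) {c : ℝ}
    (hc : ∀ t ∈ T, verModel k (w t) = c) {s t : ℝ} (hs : s ∈ T) (ht : t ∈ T)
    (hs0 : horModel k (w s) = 0) (ht0 : horModel k (w t) = 0) : s = t := by
  apply hinj hs ht
  by_cases hc0 : c = 0
  · rw [eq_zero_of_models_eq_zero hs0 ((hc s hs).trans hc0),
      eq_zero_of_models_eq_zero ht0 ((hc t ht).trans hc0)]
  · have hpos : ∀ t ∈ T, 0 < verModel k (w t) := fun t ht =>
      verModel_nonneg.lt_of_ne (by rw [hc t ht]; exact Ne.symm hc0)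
    obtain ⟨ξ, -, hξ⟩ := exists_eq_sectorMap hT hw hk hpos
    have him : ∀ t ∈ T, horModel k (w t) = 0 → modelCoord k (w t) = c := by
      intro t ht h0
      apply Complex.ext
      · simp [modelCoord, hc t ht]
      · have := abs_im_modelCoord (hpos t ht)
        rw [h0, abs_eq_zero] at this
        simpa using this
    rw [hξ s hs, hξ t ht, him s hs hs0, him t ht ht0]

end Model

/-- The last time a continuous function takes the value `c`. -/
theorem exists_last_time {v : ℝ → ℝ} {a b c : ℝ} (hab : a ≤ b) (hv : ContinuousOn v (Icc a b))
    (ha : v a ≤ c) (hb : c < v b) :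
    ∃ t₀ ∈ Ico a b, v t₀ = c ∧ ∀ t ∈ Ioc t₀ b, c < v t := by
  have hcl : IsCompact {t ∈ Icc a b | v t ∈ Iic c} := by
    refine isCompact_Icc.of_isClosed_subset ?_ (sep_subset _ _)
    exact hv.preimage_isClosed_of_isClosed isClosed_Icc isClosed_Iic
  obtain ⟨t₀, ⟨ht₀, hv₀⟩, hmax⟩ := hcl.exists_isGreatest ⟨a, ⟨le_rfl, hab⟩, ha⟩
  have hlt : t₀ < b := ht₀.2.lt_of_ne (by rintro rfl; exact absurd hv₀ (not_le.2 hb))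
  have hgt : ∀ t ∈ Ioc t₀ b, c < v t := by
    intro t ht
    by_contra! h
    exact absurd (hmax ⟨⟨ht₀.1.trans ht.1.le, ht.2⟩, h⟩) (not_le.2 ht.1)
  refine ⟨t₀, ⟨ht₀.1, hlt⟩, ?_, hgt⟩
  obtain ⟨t, ht, htc⟩ := intermediate_value_Icc hlt.le (hv.mono (Icc_subset_Icc_left ht₀.1))
    ⟨hv₀, hb.le⟩
  rcases ht.1.eq_or_lt with h | h
  · rw [h]; exact htc
  · exact absurd htc (hgt t ⟨h, ht.2⟩).ne'


/-! ### Arcs, path components and plaques -/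

namespace PreFoliation

variable {S : Type*} {A : PreFoliation S}

theorem mem_leaf_self (A : PreFoliation S) (x : S) : x ∈ A.leaf x := A.sameLeaf.refl x

theorem leaf_eq_of_mem {x y : S} (h : y ∈ A.leaf x) : A.leaf y = A.leaf x :=
  ext fun _ => ⟨fun hz => A.sameLeaf.trans h hz, fun hz => A.sameLeaf.trans (A.sameLeaf.symm h) hz⟩

end PreFoliation

section Arcs

variable {S S' : Type*} [TopologicalSpace S] [TopologicalSpace S']

theorem image_pathComponentIn_subset (h : S ≃ₜ S') (X : Set S) (x : S) :
    h '' pathComponentIn X x ⊆ pathComponentIn (h '' X) (h x) := by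
  rintro _ ⟨y, hy, rfl⟩
  exact JoinedIn.map hy h.continuous

theorem image_pathComponentIn (h : S ≃ₜ S') (X : Set S) (x : S) :
    h '' pathComponentIn X x = pathComponentIn (h '' X) (h x) := by
  refine (image_pathComponentIn_subset h X x).antisymm fun y hy => ?_
  have := image_pathComponentIn_subset h.symm (h '' X) (h x) (mem_image_of_mem _ hy)
  rw [h.symm_apply_apply, ← image_comp] at this
  exact ⟨h.symm y, by simpa using this, by simp⟩

theorem IsArc.image {a b : S} {J : Set S} (hJ : IsArc a b J) (h : S ≃ₜ S') :
    IsArc (h a) (h b) (h '' J) := by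
  obtain ⟨γ, hc, hi, h0, h1, rfl⟩ := hJ
  refine ⟨h ∘ γ, h.continuous.comp_continuousOn hc, h.injective.comp_injOn hi, ?_, ?_, ?_⟩
  · simp [h0]
  · simp [h1]
  · rw [image_comp]

theorem isArc_image_Icc {γ : ℝ → S} {s t : ℝ} (hst : s < t) (hc : ContinuousOn γ (Icc s t))
    (hi : InjOn γ (Icc s t)) : IsArc (γ s) (γ t) (γ '' Icc s t) := by
  have himg : (fun u : ℝ => s + (t - s) * u) '' Icc 0 1 = Icc s t := by
    have := image_affine_Icc' (sub_pos.2 hst) s 0 1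
    simp only [mul_zero, zero_add, mul_one, sub_add_cancel] at this
    simpa only [add_comm s] using this
  have hm : MapsTo (fun u : ℝ => s + (t - s) * u) (Icc 0 1) (Icc s t) := by
    rw [← himg]; exact mapsTo_image _ _
  refine ⟨γ ∘ fun u => s + (t - s) * u, hc.comp (by fun_prop) hm, hi.comp ?_ hm, by simp,
    by simp, by rw [image_comp, himg]⟩
  intro u _ v _ huv
  have : (t - s) * u = (t - s) * v := by simpa using huv
  exact mul_left_cancel₀ (sub_pos.2 hst).ne' this

theorem isPathConnected_image_Icc {γ : ℝ → S} {s t : ℝ} (hst : s ≤ t)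
    (hc : ContinuousOn γ (Icc s t)) : IsPathConnected (γ '' Icc s t) :=
  ((convex_Icc s t).isPathConnected (nonempty_Icc.2 hst)).image' hc

theorem IsArc.isPathConnected {a b : S} {J : Set S} (hJ : IsArc a b J) : IsPathConnected J := by
  obtain ⟨γ, hc, hi, h0, h1, rfl⟩ := hJ
  exact isPathConnected_image_Icc zero_le_one hc

namespace PreFoliation

variable {A B : PreFoliation S}

theorem IsMeasuredFoliation.meas_Icc_add (hA : A.IsMeasuredFoliation) {γ : ℝ → S} {r s t : ℝ}
    (hrs : r < s) (hst : s < t) (hc : ContinuousOn γ (Icc r t)) (hi : InjOn γ (Icc r t)) :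
    A.meas (γ '' Icc r t) = A.meas (γ '' Icc r s) + A.meas (γ '' Icc s t) := by
  have h1 : Icc r s ⊆ Icc r t := Icc_subset_Icc_right hst.le
  have h2 : Icc s t ⊆ Icc r t := Icc_subset_Icc_left hrs.le
  rw [← Icc_union_Icc_eq_Icc hrs.le hst.le, image_union]
  refine hA.meas_union _ _ _ _ _ (isArc_image_Icc hrs (hc.mono h1) (hi.mono h1))
    (isArc_image_Icc hst (hc.mono h2) (hi.mono h2)) ?_
  rw [← hi.image_inter h1 h2, Icc_inter_Icc_eq_singleton hrs.le hst.le, image_singleton]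

theorem IsMeasuredFoliation.meas_Icc_mono (hA : A.IsMeasuredFoliation) {γ : ℝ → S}
    {a b s t : ℝ} (has : a ≤ s) (hst : s < t) (htb : t ≤ b) (hc : ContinuousOn γ (Icc a b))
    (hi : InjOn γ (Icc a b)) : A.meas (γ '' Icc s t) ≤ A.meas (γ '' Icc a b) := by
  have h1 : A.meas (γ '' Icc s t) ≤ A.meas (γ '' Icc a t) := by
    rcases has.eq_or_lt with rfl | h
    · rfl
    · have h1 : Icc a t ⊆ Icc a b := Icc_subset_Icc_right htb
      rw [hA.meas_Icc_add h hst (hc.mono h1) (hi.mono h1)]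
      exact le_add_self
  refine h1.trans ?_
  rcases htb.eq_or_lt with rfl | h
  · rfl
  · rw [hA.meas_Icc_add (has.trans_lt hst) h hc hi]
    exact le_self_add

variable {φ : OpenPartialHomeomorph S ℂ} {m m' : ℂ → ℝ}

/-- A path connected set in the target of a chart, on which the model function is constant, is
contained in a leaf. -/
theorem IsModelled.mem_leaf (h : A.IsModelled φ m) {P : Set ℂ} (hP : IsPathConnected P)
    (ht : P ⊆ φ.target) {c : ℝ} (hc : ∀ z ∈ P, m z = c) {z w : ℂ} (hz : z ∈ P) (hw : w ∈ P) :
    φ.symm w ∈ A.leaf (φ.symm z) := by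
  have h1 := h.plaque (φ.symm z) (φ.map_target (ht hz))
  rw [φ.right_inv (ht hz)] at h1
  have h2 : w ∈ pathComponentIn ({w | m w = m z} ∩ φ.target) z :=
    hP.subset_pathComponentIn hz
      (subset_inter (fun v hv => (hc v hv).trans (hc z hz).symm) ht) hw
  rw [← h1] at h2
  obtain ⟨y, hy, rfl⟩ := h2
  have h3 := pathComponentIn_subset hy
  rw [φ.left_inv h3.2]
  exact h3.1

/-- On a path connected part of a leaf in the domain of a chart, the model function is constant. -/
theorem IsModelled.eq_of_isPathConnected (h : A.IsModelled φ m) {K : Set S}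
    (hK : IsPathConnected K) (hs : K ⊆ φ.source) {x : S} (hx : K ⊆ A.leaf x) {y z : S}
    (hy : y ∈ K) (hz : z ∈ K) : m (φ z) = m (φ y) := by
  have h1 : z ∈ pathComponentIn (A.leaf y ∩ φ.source) y :=
    hK.subset_pathComponentIn hy
      (subset_inter (by rwa [leaf_eq_of_mem (hx hy)]) hs) hz
  have h2 := mem_image_of_mem φ h1
  rw [h.plaque y (hs hy)] at h2
  exact (pathComponentIn_subset h2).1

/-- A curve in the target of a chart, along which the model function of `A` is constant and that of
`B` is injective, gives an arc in a leaf of `A` whose measure is the variation of the latter. -/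
theorem IsModelled.exists_arc (hA : A.IsModelled φ m) (hB : B.IsModelled φ m') {σ : ℝ → ℂ}
    (hσ : ContinuousOn σ (Icc 0 1)) (ht : ∀ t ∈ Icc (0 : ℝ) 1, σ t ∈ φ.target) {c : ℝ}
    (hc : ∀ t ∈ Icc (0 : ℝ) 1, m (σ t) = c) (hi : InjOn (fun t => m' (σ t)) (Icc 0 1)) :
    ∃ I, IsArc (φ.symm (σ 0)) (φ.symm (σ 1)) I ∧ I ⊆ A.leaf (φ.symm (σ 0)) ∧
      (I = φ.symm '' (σ '' Icc 0 1)) ∧ B.meas I = ENNReal.ofReal |m' (σ 1) - m' (σ 0)| := by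
  have h0 : (0 : ℝ) ∈ Icc (0 : ℝ) 1 := by simp
  have h1 : (1 : ℝ) ∈ Icc (0 : ℝ) 1 := by simp
  have harc : IsArc (φ.symm (σ 0)) (φ.symm (σ 1)) ((φ.symm ∘ σ) '' Icc 0 1) := by
    refine ⟨φ.symm ∘ σ, φ.continuousOn_symm.comp hσ ht, ?_, rfl, rfl, rfl⟩
    intro s hs t ht' hst
    apply hi hs ht'
    have := congrArg φ hst
    simp only [Function.comp_apply, φ.right_inv (ht s hs), φ.right_inv (ht t ht')] at this
    simp only [this]
  refine ⟨_, harc, ?_, image_comp _ _ _, ?_⟩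
  · rintro _ ⟨t, ht', rfl⟩
    exact hA.mem_leaf (isPathConnected_image_Icc zero_le_one hσ)
      (by rintro _ ⟨t, h, rfl⟩; exact ht t h)
      (c := c) (by rintro _ ⟨t, h, rfl⟩; exact hc t h) (mem_image_of_mem _ h0)
      (mem_image_of_mem _ ht')
  · have := hB.measure _ _ _ harc ?_ ?_
    · rw [this, φ.right_inv (ht 0 h0), φ.right_inv (ht 1 h1)]
    · rintro _ ⟨t, h, rfl⟩; exact φ.map_target (ht t h)
    · rintro _ ⟨s, hs, rfl⟩ _ ⟨t, ht', rfl⟩ hst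
      simp only [Function.comp_apply, φ.right_inv (ht s hs), φ.right_inv (ht t ht')] at hst
      have : s = t := hi hs ht' hst
      rw [this]

theorem IsModelled.transHomeomorph (h : A.IsModelled φ m) (e : ℂ ≃ₜ ℂ) (he : ∀ z, m' (e z) = m z) :
    A.IsModelled (φ.transHomeomorph e) m' := by
  constructor
  · intro y hy
    have h1 := h.plaque y hy
    have h2 : {w | m' w = m' ((φ.transHomeomorph e) y)} ∩ (φ.transHomeomorph e).target =
        e '' ({w | m w = m (φ y)} ∩ φ.target) := by
      ext w
      obtain ⟨v, rfl⟩ := e.surjective w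
      simp [he]
    rw [h2]
    have h3 := image_pathComponentIn e ({w | m w = m (φ y)} ∩ φ.target) (φ y)
    rw [← h1, ← image_comp] at h3
    exact h3
  · intro a b J hJ hs hi
    have : m' ∘ (φ.transHomeomorph e) = m ∘ φ := by funext x; simp [he]
    rw [this] at hi
    rw [h.measure a b J hJ hs hi]
    simp [he]

end PreFoliation

/-! ### Pairs of transverse foliations contracted and expanded by a homeomorphism -/

/-- The roles of two transverse foliations can be exchanged, by rotating the charts. -/
theorem IsCommonProng.swap {A B : PreFoliation S} {x : S} {k : ℕ} (hk : 1 ≤ k)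
    (h : IsCommonProng A B x k) : IsCommonProng B A x k := by
  obtain ⟨φ, ⟨hx, h0, r, hr, ht⟩, hA, hB⟩ := h
  obtain ⟨ξ, hξ⟩ := exists_pow_eq_neg_one hk
  have hξ1 : ‖ξ‖ = 1 := norm_eq_one_of_pow hk (by simp [hξ])
  have hξ0 : ξ ≠ 0 := by rintro rfl; simp at hξ1
  refine ⟨φ.transHomeomorph (Homeomorph.mulLeft₀ ξ hξ0), ⟨hx, by simp [h0], r, hr, ?_⟩,
    hB.transHomeomorph _ fun z => ?_, hA.transHomeomorph _ fun z => ?_⟩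
  · ext w
    obtain ⟨v, rfl⟩ := (Homeomorph.mulLeft₀ ξ hξ0).surjective w
    simp [ht, hξ1]
  · exact horModel_rotate hk hξ
  · exact verModel_rotate hk hξ

theorem AreTransverse.swap {A B : PreFoliation S} (h : AreTransverse A B) : AreTransverse B A :=
  fun x => let ⟨k, hk, hx⟩ := h x; ⟨k, hk, hx.swap hk⟩

/-- The data common to a generalized pseudo-Anosov homeomorphism and its inverse: `F` contracts the
leaves of `A` and expands the leaves of `B` by the factor `κ`. -/
structure IsHyperbolic (F : S ≃ₜ S) (A B : PreFoliation S) (κ : ℝ) : Prop where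
  left : A.IsMeasuredFoliation
  right : B.IsMeasuredFoliation
  transverse : AreTransverse A B
  one_lt : 1 < κ
  image_left : ∀ x, F '' A.leaf x = A.leaf (F x)
  image_right : ∀ x, F '' B.leaf x = B.leaf (F x)
  expand : ∀ (a b : S) (J : Set S), IsArc a b J → J ⊆ B.leaf a →
    A.meas (F '' J) = ENNReal.ofReal κ * A.meas J
  contract : ∀ (a b : S) (I : Set S), IsArc a b I → I ⊆ A.leaf a →
    B.meas (F '' I) = ENNReal.ofReal (1 / κ) * B.meas I

/-- Iteration of a homeomorphism which preserves the leaves of `B` and multiplies the measure of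
arcs in leaves of `B` by `c`. -/
theorem IsArc.iterate {F : S ≃ₜ S} {A B : PreFoliation S} {c : ENNReal}
    (hF : ∀ x, F '' B.leaf x = B.leaf (F x))
    (hm : ∀ (a b : S) (J : Set S), IsArc a b J → J ⊆ B.leaf a → A.meas (F '' J) = c * A.meas J)
    {a b : S} {J : Set S} (hJ : IsArc a b J) (hl : J ⊆ B.leaf a) (n : ℕ) :
    IsArc (F^[n] a) (F^[n] b) (F^[n] '' J) ∧ F^[n] '' J ⊆ B.leaf (F^[n] a) ∧
      A.meas (F^[n] '' J) = c ^ n * A.meas J := by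
  induction n with
  | zero => simpa using ⟨hJ, hl⟩
  | succ n ih =>
    obtain ⟨h1, h2, h3⟩ := ih
    rw [Function.iterate_succ', image_comp, Function.comp_apply, Function.comp_apply]
    refine ⟨h1.image F, ?_, ?_⟩
    · rw [← hF]; exact image_mono h2
    · rw [hm _ _ _ h1 h2, h3, pow_succ]; ring

theorem PseudoAnosov.isHyperbolic [ChartedSpace ℂ S] (f : PseudoAnosov S) :
    IsHyperbolic f.toHomeo f.stable f.unstable f.stretch :=
  ⟨f.stable_foliation, f.unstable_foliation, f.transverse, f.one_lt_stretch, f.image_stable,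
    f.image_unstable, f.expand, f.contract⟩

theorem image_symm_leaf {F : S ≃ₜ S} {A : PreFoliation S} (h : ∀ x, F '' A.leaf x = A.leaf (F x))
    (x : S) : F.symm '' A.leaf x = A.leaf (F.symm x) := by
  obtain ⟨y, rfl⟩ := F.surjective x
  rw [← h, ← image_comp]
  simp

/-- The inverse homeomorphism exchanges the contracted and the expanded foliation. -/
theorem IsHyperbolic.symm {F : S ≃ₜ S} {A B : PreFoliation S} {κ : ℝ} (h : IsHyperbolic F A B κ) :
    IsHyperbolic F.symm B A κ := by
  have h0 : 0 < κ := one_pos.trans h.one_lt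
  have hκ : ENNReal.ofReal (1 / κ) * ENNReal.ofReal κ = 1 := by
    rw [← ENNReal.ofReal_mul (by positivity), one_div_mul_cancel h0.ne', ENNReal.ofReal_one]
  have himg : ∀ J : Set S, F '' (F.symm '' J) = J := fun J => by rw [← image_comp]; simp
  refine ⟨h.right, h.left, h.transverse.swap, h.one_lt, image_symm_leaf h.image_right,
    image_symm_leaf h.image_left, fun a b J hJ hl => ?_, fun a b J hJ hl => ?_⟩
  · have := h.contract _ _ _ (hJ.image F.symm)
      (by rw [← image_symm_leaf h.image_left]; exact image_mono hl)
    rw [himg] at this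
    rw [this, ← mul_assoc, mul_comm (ENNReal.ofReal κ), hκ, one_mul]
  · have := h.expand _ _ _ (hJ.image F.symm)
      (by rw [← image_symm_leaf h.image_right]; exact image_mono hl)
    rw [himg] at this
    rw [this, ← mul_assoc, hκ, one_mul]

end Arcs

/-! ### Short and long arcs -/

section Estimates

variable {S : Type*}

theorem PreFoliation.IsModelled.meas_image_Icc [TopologicalSpace S] {B : PreFoliation S}
    {φ : OpenPartialHomeomorph S ℂ} {m : ℂ → ℝ} (hB : B.IsModelled φ m) {γ : ℝ → S} {s t : ℝ}
    (hst : s < t) (hc : ContinuousOn γ (Icc s t)) (hi : InjOn γ (Icc s t))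
    (hs : MapsTo γ (Icc s t) φ.source) (hm : InjOn (fun u => m (φ (γ u))) (Icc s t)) :
    B.meas (γ '' Icc s t) = ENNReal.ofReal |m (φ (γ t)) - m (φ (γ s))| := by
  refine hB.measure _ _ _ (isArc_image_Icc hst hc hi) hs.image_subset ?_
  rintro _ ⟨u, hu, rfl⟩ _ ⟨v, hv, rfl⟩ huv
  rw [hm hu hv huv]

variable [UniformSpace S] {A B : PreFoliation S}

/-- Near a given point, arcs in leaves of `A` of small measure are small: an arc which leaves a disc
chart contains a piece crossing an annulus, along which the transverse coordinate is monotone and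
varies by a definite amount. -/
theorem exists_nhds_meas_lt_imp_mem [T2Space S] (hB : B.IsMeasuredFoliation)
    (hAB : AreTransverse A B) {V : Set (S × S)} (hV : V ∈ uniformity S) (x : S) :
    ∃ U ∈ 𝓝 x, ∃ η > 0, ∀ a ∈ U, ∀ b I, IsArc a b I → I ⊆ A.leaf a →
      B.meas I < ENNReal.ofReal η → (a, b) ∈ V := by
  obtain ⟨k, hk, φ, ⟨hx, h0, R, hR, ht⟩, hA', hB'⟩ := hAB x
  obtain ⟨V₁, hV₁, hsymm, hcomp⟩ := comp_symm_mem_uniformity_sets hV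
  have hx0 : φ.symm 0 = x := by rw [← h0, φ.left_inv hx]
  have hk0 : k ≠ 0 := by omega
  -- a closed disc of radius `r` in the chart, contained in a small neighbourhood of `x`
  obtain ⟨r, hr, hrR, hrV⟩ : ∃ r > 0, r < R ∧ ∀ z ∈ Metric.closedBall (0 : ℂ) r,
      (x, φ.symm z) ∈ V₁ := by
    have h1 : φ.symm ⁻¹' UniformSpace.ball x V₁ ∈ 𝓝 (0 : ℂ) := by
      refine (φ.continuousAt_symm (x := 0) (by rw [ht]; simpa using hR)).preimage_mem_nhds ?_
      rw [hx0]; exact UniformSpace.ball_mem_nhds x hV₁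
    obtain ⟨δ, hδ, hball⟩ := Metric.nhds_basis_closedBall.mem_iff.1 h1
    refine ⟨min δ (R / 2), lt_min hδ (by linarith), (min_le_right _ _).trans_lt (by linarith),
      fun z hz => hball (Metric.closedBall_subset_closedBall (min_le_left _ _) hz)⟩
  have hrt : Metric.closedBall (0 : ℂ) r ⊆ φ.target := by
    rw [ht]; exact Metric.closedBall_subset_ball hrR
  have hO : ∀ ρ, IsOpen (φ.source ∩ φ ⁻¹' Metric.ball 0 ρ) := fun ρ =>
    φ.isOpen_inter_preimage Metric.isOpen_ball
  -- on a leaf `{horModel = c}`, the square of `verModel` grows by `r ^ k - (r / 2) ^ k` across the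
  -- annulus `r / 2 < |z| < r`, while `verModel` is at most `√(r ^ k)`
  have hrk : 0 < r ^ k - (r / 2) ^ k := by
    have := pow_lt_pow_left₀ (show r / 2 < r by linarith) (by positivity) hk0
    linarith
  have hQ : 0 < Real.sqrt (r ^ k) := Real.sqrt_pos.2 (by positivity)
  refine ⟨φ.source ∩ φ ⁻¹' Metric.ball 0 (r / 2), (hO _).mem_nhds ⟨hx, ?_⟩,
    (r ^ k - (r / 2) ^ k) / (2 * Real.sqrt (r ^ k)), by positivity, ?_⟩
  · simpa [h0] using hr
  rintro a ⟨haS, haφ⟩ b I hI hIl hmeas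
  by_contra hab
  obtain ⟨γ, hc, hi, rfl, rfl, rfl⟩ := hI
  have haφ : ‖φ (γ 0)‖ < r / 2 := by simpa using haφ
  have hVa : ∀ y ∈ φ.source ∩ φ ⁻¹' Metric.closedBall 0 r, (x, y) ∈ V₁ := by
    rintro y ⟨hy, hy'⟩
    have := hrV _ hy'
    rwa [φ.left_inv hy] at this
  -- the first exit time from the open disc
  have hcl : IsCompact {t ∈ Icc (0 : ℝ) 1 | γ t ∈ (φ.source ∩ φ ⁻¹' Metric.ball 0 r)ᶜ} :=
    isCompact_Icc.of_isClosed_subset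
      (hc.preimage_isClosed_of_isClosed isClosed_Icc (hO r).isClosed_compl) (sep_subset _ _)
  obtain ⟨t₁, ⟨ht₁, hγ₁⟩, hmin⟩ := hcl.exists_isLeast ⟨1, by simp, fun h => hab <| hcomp <|
    SetRel.prodMk_mem_comp (hsymm.symm _ _ (hVa _ ⟨haS, by simpa using haφ.le.trans (by linarith)⟩))
      (hVa _ ⟨h.1, Metric.ball_subset_closedBall h.2⟩)⟩
  have ht0 : 0 < t₁ := ht₁.1.lt_of_ne <| by
    rintro rfl
    exact hγ₁ ⟨haS, by simpa using haφ.trans (by linarith)⟩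
  have hsub : Icc 0 t₁ ⊆ Icc 0 1 := Icc_subset_Icc_right ht₁.2
  have hK : IsClosed (φ.symm '' Metric.closedBall 0 r) :=
    ((isCompact_closedBall _ _).image_of_continuousOn (φ.continuousOn_symm.mono hrt)).isClosed
  have hin : ∀ t ∈ Icc 0 t₁, γ t ∈ φ.symm '' Metric.closedBall 0 r := by
    have h1 : IsClosed {t ∈ Icc (0 : ℝ) 1 | γ t ∈ φ.symm '' Metric.closedBall 0 r} :=
      hc.preimage_isClosed_of_isClosed isClosed_Icc hK
    have h2 : Ico 0 t₁ ⊆ {t ∈ Icc (0 : ℝ) 1 | γ t ∈ φ.symm '' Metric.closedBall 0 r} := by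
      intro t htt
      have htI : t ∈ Icc (0 : ℝ) 1 := hsub (Ico_subset_Icc_self htt)
      refine ⟨htI, ?_⟩
      by_contra h
      refine absurd (hmin ⟨htI, fun hO => h ?_⟩) (not_le.2 htt.2)
      exact ⟨_, Metric.ball_subset_closedBall hO.2, φ.left_inv hO.1⟩
    have h3 := h1.closure_subset_iff.2 h2
    rw [closure_Ico ht0.ne] at h3
    exact fun t ht => (h3 ht).2
  have hsrc : MapsTo γ (Icc 0 t₁) φ.source := by
    intro t htt
    obtain ⟨z, hz, hzt⟩ := hin t htt
    rw [← hzt]; exact φ.map_target (hrt hz)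
  have hnorm : ∀ t ∈ Icc 0 t₁, ‖φ (γ t)‖ ≤ r := by
    intro t htt
    obtain ⟨z, hz, hzt⟩ := hin t htt
    rw [← hzt, φ.right_inv (hrt hz)]; simpa using hz
  have h0m : (0 : ℝ) ∈ Icc 0 t₁ := ⟨le_rfl, ht0.le⟩
  have h1m : t₁ ∈ Icc 0 t₁ := ⟨ht0.le, le_rfl⟩
  have hnorm1 : ‖φ (γ t₁)‖ = r := by
    refine (hnorm _ h1m).antisymm ?_
    by_contra! h
    exact hγ₁ ⟨hsrc h1m, by simpa using h⟩
  have hcw : ContinuousOn (fun t => φ (γ t)) (Icc 0 t₁) :=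
    φ.continuousOn.comp (hc.mono hsub) hsrc
  have hhor : ∀ t ∈ Icc 0 t₁, horModel k (φ (γ t)) = horModel k (φ (γ 0)) := fun t htt =>
    hA'.eq_of_isPathConnected (isPathConnected_image_Icc ht0.le (hc.mono hsub)) hsrc.image_subset
      ((image_mono hsub).trans hIl) (mem_image_of_mem _ h0m) (mem_image_of_mem _ htt)
  have hsq0 := horModel_sq_add_verModel_sq (k := k) (z := φ (γ 0))
  have hsq1 := horModel_sq_add_verModel_sq (k := k) (z := φ (γ t₁))
  rw [hhor _ h1m, hnorm1] at hsq1
  have hpow : ‖φ (γ 0)‖ ^ k ≤ (r / 2) ^ k := pow_le_pow_left₀ (norm_nonneg _) haφ.le k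
  have hv0 := verModel_nonneg (k := k) (z := φ (γ 0))
  have hv1 := verModel_nonneg (k := k) (z := φ (γ t₁))
  have hlt : verModel k (φ (γ 0)) < verModel k (φ (γ t₁)) := by
    apply lt_of_pow_lt_pow_left₀ 2 hv1
    linarith
  obtain ⟨t₀, ht₀, hvt₀, hgt⟩ := exists_last_time ht0.le
    (continuous_verModel (k := k).comp_continuousOn hcw) le_rfl hlt
  have hsub' : Icc t₀ t₁ ⊆ Icc 0 t₁ := Icc_subset_Icc_left ht₀.1
  have hIoc : Ioc t₀ t₁ ⊆ Icc t₀ t₁ := Ioc_subset_Icc_self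
  have hinj : InjOn (fun t => verModel k (φ (γ t))) (Icc t₀ t₁) := by
    have h1 : InjOn (fun t => verModel k (φ (γ t))) (Ioc t₀ t₁) :=
      injOn_verModel isPreconnected_Ioc (hcw.mono (hIoc.trans hsub'))
        (φ.injOn.comp (hi.mono (hIoc.trans (hsub'.trans hsub))) (hsrc.mono_left (hIoc.trans hsub')))
        hk (fun t htt => hv0.trans_lt (hgt t htt)) (fun t htt => hhor t (hsub' (hIoc htt)))
    rw [← Ioc_insert_left ht₀.2.le, injOn_insert (by simp)]
    refine ⟨h1, ?_⟩
    rintro ⟨t, htt, heq⟩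
    exact absurd (heq.trans hvt₀) (hgt t htt).ne'
  have hmeas' := hB'.meas_image_Icc ht₀.2 (hc.mono (hsub'.trans hsub))
    (hi.mono (hsub'.trans hsub)) (hsrc.mono_left hsub') hinj
  have hmono := hB.meas_Icc_mono ht₀.1 ht₀.2 ht₁.2 hc hi
  rw [hmeas'] at hmono
  have := (ENNReal.ofReal_lt_ofReal_iff_of_nonneg (abs_nonneg _)).1 (hmono.trans_lt hmeas)
  have hvt₀' : verModel k (φ (γ t₀)) = verModel k (φ (γ 0)) := hvt₀
  rw [hvt₀', abs_of_pos (sub_pos.2 hlt), lt_div_iff₀ (by positivity)] at this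
  have hle1 := verModel_le (k := k) (z := φ (γ t₁))
  rw [hnorm1] at hle1
  nlinarith

/-- Arcs in leaves of `A` of small measure are small. -/
theorem exists_meas_lt_imp_mem [T2Space S] [CompactSpace S] (hB : B.IsMeasuredFoliation)
    (hAB : AreTransverse A B) {V : Set (S × S)} (hV : V ∈ uniformity S) :
    ∃ η > 0, ∀ a b I, IsArc a b I → I ⊆ A.leaf a → B.meas I < ENNReal.ofReal η → (a, b) ∈ V := by
  have key := isCompact_univ.induction_on (X := S)
    (p := fun U => ∃ η > 0, ∀ a ∈ U, ∀ b I, IsArc a b I → I ⊆ A.leaf a →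
      B.meas I < ENNReal.ofReal η → (a, b) ∈ V) ?_ ?_ ?_ ?_
  · simpa using key
  · exact ⟨1, one_pos, by simp⟩
  · rintro U U' hU ⟨η, hη, h⟩
    exact ⟨η, hη, fun a ha => h a (hU ha)⟩
  · rintro U U' ⟨η, hη, h⟩ ⟨η', hη', h'⟩
    refine ⟨min η η', lt_min hη hη', fun a ha b I hI hl hm => ha.elim (fun ha => ?_) fun ha => ?_⟩
    · exact h a ha b I hI hl (hm.trans_le (ENNReal.ofReal_le_ofReal (min_le_left _ _)))
    · exact h' a ha b I hI hl (hm.trans_le (ENNReal.ofReal_le_ofReal (min_le_right _ _)))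
  · intro x _
    obtain ⟨U, hU, h⟩ := exists_nhds_meas_lt_imp_mem hB hAB hV x
    exact ⟨U, mem_nhdsWithin_of_mem_nhds hU, h⟩

/-- In a chart, arcs in leaves of `B` have bounded measure: such an arc is cut by the zero set of
the transverse coordinate into at most two pieces on which this coordinate is monotone. -/
theorem meas_le_of_subset_source {k : ℕ} (hk : 1 ≤ k) (hA : A.IsMeasuredFoliation)
    {φ : OpenPartialHomeomorph S ℂ} {R : ℝ} (ht : φ.target = Metric.ball 0 R)
    (hA' : A.IsModelled φ (horModel k)) (hB' : B.IsModelled φ (verModel k)) {a b : S} {J : Set S}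
    (hJ : IsArc a b J) (hl : J ⊆ B.leaf a) (hs : J ⊆ φ.source) :
    A.meas J ≤ ENNReal.ofReal (2 * Real.sqrt (R ^ k)) := by
  have hpc := hJ.isPathConnected
  obtain ⟨γ, hc, hi, rfl, rfl, rfl⟩ := hJ
  have hsrc : MapsTo γ (Icc 0 1) φ.source := fun t ht => hs (mem_image_of_mem _ ht)
  have hcw : ContinuousOn (fun t => φ (γ t)) (Icc 0 1) := φ.continuousOn.comp hc hsrc
  have hiw : InjOn (fun t => φ (γ t)) (Icc 0 1) := φ.injOn.comp hi hsrc
  have hver : ∀ t ∈ Icc (0 : ℝ) 1, verModel k (φ (γ t)) = verModel k (φ (γ 0)) := fun t htt =>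
    hB'.eq_of_isPathConnected hpc hs hl (mem_image_of_mem _ (by simp)) (mem_image_of_mem _ htt)
  have huniq : ∀ s ∈ Icc (0 : ℝ) 1, ∀ t ∈ Icc (0 : ℝ) 1, horModel k (φ (γ s)) = 0 →
      horModel k (φ (γ t)) = 0 → s = t := fun s hs' t ht' =>
    eq_of_horModel_eq_zero isPreconnected_Icc hcw hiw hk hver hs' ht'
  have hle : ∀ t ∈ Icc (0 : ℝ) 1, horModel k (φ (γ t)) ≤ Real.sqrt (R ^ k) := by
    intro t htt
    refine horModel_le.trans (Real.sqrt_le_sqrt (pow_le_pow_left₀ (norm_nonneg _) ?_ k))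
    have := φ.map_source (hsrc htt)
    rw [ht] at this
    simpa using (mem_ball_zero_iff.1 this).le
  have piece : ∀ s t, 0 ≤ s → s < t → t ≤ 1 → (∀ u ∈ Ioo s t, horModel k (φ (γ u)) ≠ 0) →
      A.meas (γ '' Icc s t) ≤ ENNReal.ofReal (Real.sqrt (R ^ k)) := by
    intro s t h0s hst ht1 hne
    have hsub : Icc s t ⊆ Icc 0 1 := Icc_subset_Icc h0s ht1
    have hP : IsPreconnected {u ∈ Icc s t | 0 < horModel k (φ (γ u))} := by
      refine (isPreconnected_Ioo (a := s) (b := t)).subset_closure (fun u hu =>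
        ⟨Ioo_subset_Icc_self hu, horModel_nonneg.lt_of_ne (hne u hu).symm⟩) ?_
      rw [closure_Ioo hst.ne]; exact sep_subset _ _
    have hPs : {u ∈ Icc s t | 0 < horModel k (φ (γ u))} ⊆ Icc 0 1 := (sep_subset _ _).trans hsub
    have hinj := injOn_horModel hP (hcw.mono hPs) (hiw.mono hPs) hk (fun u hu => hu.2)
      (fun u hu => hver u (hPs hu))
    have hinj' : InjOn (fun u => horModel k (φ (γ u))) (Icc s t) := by
      intro u hu v hv huv
      have huv' : horModel k (φ (γ u)) = horModel k (φ (γ v)) := huv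
      rcases (horModel_nonneg (k := k) (z := φ (γ u))).eq_or_lt with h | h
      · exact huniq u (hsub hu) v (hsub hv) h.symm (by rw [← huv', ← h])
      · exact hinj ⟨hu, h⟩ ⟨hv, huv' ▸ h⟩ huv
    rw [hA'.meas_image_Icc hst (hc.mono hsub) (hi.mono hsub) (hsrc.mono_left hsub) hinj']
    apply ENNReal.ofReal_le_ofReal
    have h1 := hle s (hsub ⟨le_rfl, hst.le⟩)
    have h2 := hle t (hsub ⟨hst.le, le_rfl⟩)
    have h3 := horModel_nonneg (k := k) (z := φ (γ s))
    have h4 := horModel_nonneg (k := k) (z := φ (γ t))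
    rw [abs_le]; constructor <;> linarith
  have hQ : 0 ≤ Real.sqrt (R ^ k) := Real.sqrt_nonneg _
  by_cases hz : ∃ t ∈ Ioo (0 : ℝ) 1, horModel k (φ (γ t)) = 0
  · obtain ⟨t, ht', htz⟩ := hz
    have htI := Ioo_subset_Icc_self ht'
    rw [hA.meas_Icc_add ht'.1 ht'.2 hc hi, two_mul, ENNReal.ofReal_add hQ hQ]
    refine add_le_add (piece 0 t le_rfl ht'.1 ht'.2.le fun u hu hu0 => ?_)
      (piece t 1 ht'.1.le ht'.2 le_rfl fun u hu hu0 => ?_)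
    · exact hu.2.ne (huniq u ⟨hu.1.le, hu.2.le.trans htI.2⟩ t htI hu0 htz)
    · exact hu.1.ne' (huniq u ⟨htI.1.trans hu.1.le, hu.2.le⟩ t htI hu0 htz)
  · push Not at hz
    exact (piece 0 1 le_rfl one_pos le_rfl hz).trans (ENNReal.ofReal_le_ofReal (by linarith))

/-- Small arcs in leaves of `B` have bounded measure. -/
theorem exists_meas_le_of_small [CompactSpace S] (hA : A.IsMeasuredFoliation)
    (hAB : AreTransverse A B) :
    ∃ V ∈ uniformity S, ∃ C : ℝ, ∀ p a b J, IsArc a b J → J ⊆ B.leaf a →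
      (∀ y ∈ J, (p, y) ∈ V) → A.meas J ≤ ENNReal.ofReal C := by
  have key := isCompact_univ.induction_on (X := S)
    (p := fun U => ∃ V ∈ uniformity S, ∃ C : ℝ, ∀ p ∈ U, ∀ a b J, IsArc a b J → J ⊆ B.leaf a →
      (∀ y ∈ J, (p, y) ∈ V) → A.meas J ≤ ENNReal.ofReal C) ?_ ?_ ?_ ?_
  · simpa using key
  · exact ⟨univ, univ_mem, 1, by simp⟩
  · rintro U U' hU ⟨V, hV, C, h⟩
    exact ⟨V, hV, C, fun p hp => h p (hU hp)⟩
  · rintro U U' ⟨V, hV, C, h⟩ ⟨V', hV', C', h'⟩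
    refine ⟨V ∩ V', inter_mem hV hV', max C C', fun p hp a b J hJ hl hm =>
      hp.elim (fun hp => ?_) fun hp => ?_⟩
    · exact (h p hp a b J hJ hl fun y hy => (hm y hy).1).trans
        (ENNReal.ofReal_le_ofReal (le_max_left _ _))
    · exact (h' p hp a b J hJ hl fun y hy => (hm y hy).2).trans
        (ENNReal.ofReal_le_ofReal (le_max_right _ _))
  · intro x _
    obtain ⟨k, hk, φ, ⟨hx, h0, R, hR, ht⟩, hA', hB'⟩ := hAB x
    obtain ⟨V₀, hV₀, hV₀s⟩ := UniformSpace.mem_nhds_iff.1 (φ.open_source.mem_nhds hx)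
    obtain ⟨V₁, hV₁, hcomp⟩ := comp_mem_uniformity_sets hV₀
    refine ⟨UniformSpace.ball x V₁, mem_nhdsWithin_of_mem_nhds (UniformSpace.ball_mem_nhds x hV₁),
      V₁, hV₁, 2 * Real.sqrt (R ^ k), fun p hp a b J hJ hl hm => ?_⟩
    exact meas_le_of_subset_source hk hA ht hA' hB' hJ hl
      fun y hy => hV₀s (hcomp (SetRel.prodMk_mem_comp hp (hm y hy)))

/-- Arcs of bounded measure in contracted leaves become uniformly small under iteration. -/
theorem IsHyperbolic.eventually_mem [T2Space S] [CompactSpace S] {F : S ≃ₜ S} {κ : ℝ}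
    (h : IsHyperbolic F A B κ) {V : Set (S × S)} (hV : V ∈ uniformity S) (C : ℝ) :
    ∀ᶠ n : ℕ in atTop, ∀ a b I, IsArc a b I → I ⊆ A.leaf a → B.meas I ≤ ENNReal.ofReal C →
      (F^[n] a, F^[n] b) ∈ V := by
  obtain ⟨η, hη, hsmall⟩ := exists_meas_lt_imp_mem h.right h.transverse hV
  have hκ : 0 < 1 / κ := one_div_pos.2 (one_pos.trans h.one_lt)
  have hlim : Tendsto (fun n : ℕ => (1 / κ) ^ n * C) atTop (𝓝 (0 * C)) :=
    (tendsto_pow_atTop_nhds_zero_of_lt_one hκ.le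
      ((div_lt_one (one_pos.trans h.one_lt)).2 h.one_lt)).mul_const C
  rw [zero_mul] at hlim
  filter_upwards [hlim.eventually_lt_const hη] with n hn a b I hI hl hm
  obtain ⟨h1, h2, h3⟩ := hI.iterate h.image_left h.contract hl n
  refine hsmall _ _ _ h1 h2 ?_
  rw [h3, ← ENNReal.ofReal_pow hκ.le]
  calc _ ≤ ENNReal.ofReal ((1 / κ) ^ n) * ENNReal.ofReal C := by gcongr
    _ = ENNReal.ofReal ((1 / κ) ^ n * C) := (ENNReal.ofReal_mul (by positivity)).symm
    _ < _ := (ENNReal.ofReal_lt_ofReal_iff hη).2 hn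

end Estimates

/-! ### A topological description of the leaves -/

section StablyJoined

variable {S : Type*} [UniformSpace S]

/-- `x` and `y` are joined by a path which locally is uniformly contracted by the iterates of `F`.
Only the topology enters this notion, so that conjugacies preserve it. The path cannot be dispensed
with: near a spine, orbits on different leaves may fellow-travel, so points with forward asymptotic
orbits need not lie on one leaf. -/
def StablyJoined (F : S → S) (x y : S) : Prop :=
  ∃ γ : ℝ → S, Continuous γ ∧ γ 0 = x ∧ γ 1 = y ∧
    ∀ t, ∃ T ∈ 𝓝 t, ∀ V ∈ uniformity S, ∀ᶠ n in atTop, ∀ s ∈ T, (F^[n] (γ t), F^[n] (γ s)) ∈ V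

theorem StablyJoined.map [CompactSpace S] {S' : Type*} [UniformSpace S'] (h : S ≃ₜ S')
    {F : S → S} {G : S' → S'} (hFG : ∀ x, h (F x) = G (h x)) {x y : S} (hxy : StablyJoined F x y) :
    StablyJoined G (h x) (h y) := by
  obtain ⟨γ, hγ, rfl, rfl, hst⟩ := hxy
  refine ⟨h ∘ γ, h.continuous.comp hγ, rfl, rfl, fun t => ?_⟩
  obtain ⟨T, hT, hV⟩ := hst t
  refine ⟨T, hT, fun V hV' => ?_⟩
  have hu := CompactSpace.uniformContinuous_of_continuous h.continuous
  filter_upwards [hV _ (hu hV')] with n hn s hs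
  have hsemi : Function.Semiconj h F G := hFG
  have := hn s hs
  simpa [(hsemi.iterate_right n).eq] using this

variable {A B : PreFoliation S} {F : S ≃ₜ S} {κ : ℝ}

/-- A point of the singular leaf of a prong is joined to the centre by a radial arc; these arcs have
bounded measure. -/
theorem exists_radial_arc {k : ℕ} (hk : 1 ≤ k) {φ : OpenPartialHomeomorph S ℂ} {R : ℝ}
    (ht : φ.target = Metric.ball 0 R) (hA : A.IsModelled φ (horModel k))
    (hB : B.IsModelled φ (verModel k)) {w : ℂ} (hw : ‖w‖ < R) (hw0 : w ≠ 0)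
    (hh : horModel k w = 0) :
    ∃ I, IsArc (φ.symm 0) (φ.symm w) I ∧ I ⊆ A.leaf (φ.symm 0) ∧
      B.meas I ≤ ENNReal.ofReal (Real.sqrt (R ^ k)) := by
  have hv : 0 < verModel k w :=
    verModel_nonneg.lt_of_ne fun h => hw0 (eq_zero_of_models_eq_zero hh h.symm)
  have hk0 : k ≠ 0 := by omega
  have key := hA.exists_arc hB (σ := fun τ : ℝ => (τ : ℂ) * w) (c := 0)
    (by fun_prop) ?_ ?_ ?_
  · obtain ⟨I, h1, h2, -, h3⟩ := key
    simp only [Complex.ofReal_zero, zero_mul, Complex.ofReal_one, one_mul] at h1 h2 h3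
    refine ⟨I, h1, h2, h3.le.trans (ENNReal.ofReal_le_ofReal ?_)⟩
    rw [verModel_zero hk, sub_zero, abs_of_pos hv]
    exact verModel_le.trans (Real.sqrt_le_sqrt (pow_le_pow_left₀ (norm_nonneg _) hw.le k))
  · intro τ hτ
    rw [ht, mem_ball_zero_iff, norm_mul, Complex.norm_of_nonneg hτ.1]
    exact (mul_le_of_le_one_left (norm_nonneg _) hτ.2).trans_lt hw
  · intro τ hτ
    rw [horModel_smul τ hτ.1, hh, mul_zero]
  · intro s hs t ht' hst
    simp only [verModel_smul s hs.1, verModel_smul t ht'.1] at hst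
    have h1 := mul_right_cancel₀ hv.ne' hst
    rw [Real.sqrt_inj (pow_nonneg hs.1 _) (pow_nonneg ht'.1 _)] at h1
    exact (pow_left_inj₀ hs.1 ht'.1 hk0).1 h1

/-- A path in a leaf of `A` is locally contracted: near each of its points it runs in the singular
leaf of a chart centred at this point, where radial arcs lead back to the centre. -/
theorem IsHyperbolic.stablyJoined [T2Space S] [CompactSpace S] (h : IsHyperbolic F A B κ) {x y : S}
    (hy : y ∈ A.leaf x) : StablyJoined F x y := by
  obtain ⟨γ, hγ⟩ := (h.left.leaf_connected x).joinedIn x (A.mem_leaf_self x) y hy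
  have hl : ∀ t, γ.extend t ∈ A.leaf x := fun t => hγ _
  refine ⟨γ.extend, γ.continuous_extend, by simp, by simp, fun t => ?_⟩
  obtain ⟨k, hk, φ, ⟨hx, h0, R, hR, ht⟩, hA, hB⟩ := h.transverse (γ.extend t)
  obtain ⟨δ, hδ, hT⟩ := Metric.mem_nhds_iff.1
    (γ.continuous_extend.continuousAt.preimage_mem_nhds (φ.open_source.mem_nhds hx))
  refine ⟨Metric.ball t δ, Metric.ball_mem_nhds t hδ, fun V hV => ?_⟩
  filter_upwards [h.eventually_mem hV (Real.sqrt (R ^ k))] with n hn s hs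
  have hhor : horModel k (φ (γ.extend s)) = 0 := by
    have hp := ((convex_ball t δ).isPathConnected ⟨t, Metric.mem_ball_self hδ⟩).image
      γ.continuous_extend
    rw [hA.eq_of_isPathConnected hp (image_subset_iff.2 hT) (x := x)
      (by rintro _ ⟨u, -, rfl⟩; exact hl u) (mem_image_of_mem _ (Metric.mem_ball_self hδ))
      (mem_image_of_mem _ hs), h0, horModel_zero hk]
  have hsrc : γ.extend s ∈ φ.source := hT hs
  have hw : ‖φ (γ.extend s)‖ < R := by
    have := φ.map_source hsrc
    rwa [ht, mem_ball_zero_iff] at this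
  have hsymm0 : φ.symm 0 = γ.extend t := by rw [← h0, φ.left_inv hx]
  by_cases hw0 : φ (γ.extend s) = 0
  · have : γ.extend s = γ.extend t := by rw [← φ.left_inv hsrc, hw0, hsymm0]
    rw [this]; exact refl_mem_uniformity hV
  · obtain ⟨I, h1, h2, h3⟩ := exists_radial_arc hk ht hA hB hw hw0 hhor
    rw [hsymm0, φ.left_inv hsrc] at h1
    rw [hsymm0] at h2
    exact hn _ _ I h1 h2 h3

/-- A point `z` with `verModel k z > 0` is joined to the axis of its sector, along a leaf of the
vertical model foliation, by an arc of bounded measure. -/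
theorem exists_arc_to_axis {k : ℕ} (hk : 1 ≤ k) {φ : OpenPartialHomeomorph S ℂ} {R : ℝ}
    (ht : φ.target = Metric.ball 0 R) (hA : A.IsModelled φ (verModel k))
    (hB : B.IsModelled φ (horModel k)) {ξ : ℂ} (hξ : ξ ^ k = 1) {z : ℂ} (hz : ‖z‖ < R)
    (hv : 0 < verModel k z) (hzξ : z = ξ * sectorMap k (modelCoord k z))
    (hh : horModel k z ≠ 0) :
    ∃ I, IsArc (φ.symm (ξ * sectorMap k (verModel k z))) (φ.symm z) I ∧
      I ⊆ A.leaf (φ.symm (ξ * sectorMap k (verModel k z))) ∧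
      B.meas I ≤ ENNReal.ofReal (Real.sqrt (R ^ k)) := by
  set v := verModel k z with hvdef
  set y := (modelCoord k z).im with hy
  have hyh : |y| = horModel k z := abs_im_modelCoord hv
  have hζ : modelCoord k z = v + y * Complex.I := by
    rw [hy, ← show (modelCoord k z).re = v from rfl, Complex.re_add_im]
  have hpow : ∀ τ : ℝ, (ξ * sectorMap k (v + (τ * y : ℝ) * Complex.I)) ^ k =
      ((v : ℂ) + (τ * y : ℝ) * Complex.I) ^ 2 := fun τ => by
    rw [mul_pow, hξ, one_mul, sectorMap_pow hk]
  have hhor : ∀ τ : ℝ, 0 ≤ τ →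
      horModel k (ξ * sectorMap k (v + (τ * y : ℝ) * Complex.I)) = τ * |y| := fun τ hτ => by
    rw [horModel_of_sq (hpow τ)]; simp [abs_mul, abs_of_nonneg hτ]
  have hver : ∀ τ : ℝ, verModel k (ξ * sectorMap k (v + (τ * y : ℝ) * Complex.I)) = v := fun τ => by
    rw [verModel_of_sq (hpow τ)]; simpa using abs_of_pos hv
  have hbd : Real.sqrt (‖z‖ ^ k) ≤ Real.sqrt (R ^ k) :=
    Real.sqrt_le_sqrt (pow_le_pow_left₀ (norm_nonneg _) hz.le k)
  have key := hA.exists_arc hB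
    (σ := fun τ : ℝ => ξ * sectorMap k (v + (τ * y : ℝ) * Complex.I)) (c := v) ?_ ?_
    (fun τ _ => hver τ) ?_
  · obtain ⟨I, h1, h2, -, h3⟩ := key
    simp only [zero_mul, Complex.ofReal_zero, add_zero, one_mul, ← hζ, ← hzξ] at h1 h2 h3
    refine ⟨I, h1, h2, h3.le.trans (ENNReal.ofReal_le_ofReal ?_)⟩
    have h0 := hhor 0 le_rfl
    simp only [zero_mul, Complex.ofReal_zero, add_zero] at h0
    rw [h0, sub_zero, abs_of_nonneg horModel_nonneg]
    exact horModel_le.trans hbd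
  · intro τ _
    refine ContinuousAt.continuousWithinAt (continuousAt_const.mul ?_)
    exact ContinuousAt.comp (g := sectorMap k) (continuousAt_sectorMap (by simpa using hv))
      (by fun_prop)
  · intro τ hτ
    rw [ht, mem_ball_zero_iff]
    refine lt_of_le_of_lt (le_of_pow_le_pow_left₀ (n := k) (by omega) (norm_nonneg _) ?_) hz
    rw [← horModel_sq_add_verModel_sq, ← horModel_sq_add_verModel_sq, hver, hhor τ hτ.1, ← hyh]
    have : (τ * |y|) ^ 2 ≤ |y| ^ 2 := pow_le_pow_left₀ (mul_nonneg hτ.1 (abs_nonneg _))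
      (mul_le_of_le_one_left (abs_nonneg _) hτ.2) 2
    linarith
  · intro s hs t ht' hst
    simp only [hhor s hs.1, hhor t ht'.1] at hst
    exact mul_right_cancel₀ (by rw [hyh]; exact hh) hst

/-- A path contracted by the iterates of `F` stays locally in a leaf of `A`. Otherwise it would
cross an interval of leaves of `A` inside a sector of a prong chart; the piece `J` of the axis of
this sector crossing the same leaves is joined to the path by arcs in leaves of `A` of bounded
measure, so that the iterates of `J` would become small, whereas their measures grow. -/
theorem IsHyperbolic.eventually_mem_leaf [T2Space S] [CompactSpace S] (h : IsHyperbolic F A B κ)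
    {γ : ℝ → S} (hγ : Continuous γ) {t : ℝ} {T : Set ℝ} (hT : T ∈ 𝓝 t)
    (hst : ∀ V ∈ uniformity S, ∀ᶠ n in atTop, ∀ s ∈ T, (F^[n] (γ t), F^[n] (γ s)) ∈ V) :
    ∀ᶠ s in 𝓝 t, γ s ∈ A.leaf (γ t) := by
  obtain ⟨k, hk, φ, ⟨hx, h0, R, hR, ht⟩, hB, hA⟩ := h.transverse.swap (γ t)
  obtain ⟨δ, hδ, hball⟩ := Metric.mem_nhds_iff.1
    (inter_mem hT (hγ.continuousAt.preimage_mem_nhds (φ.open_source.mem_nhds hx)))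
  have hnorm : ∀ s ∈ Metric.ball t δ, ‖φ (γ s)‖ < R := by
    intro s hs
    have := φ.map_source (hball hs).2
    rwa [ht, mem_ball_zero_iff] at this
  have hsymm0 : φ.symm 0 = γ t := by rw [← h0, φ.left_inv hx]
  suffices hver : ∀ s ∈ Metric.ball t δ, verModel k (φ (γ s)) = 0 by
    filter_upwards [Metric.ball_mem_nhds t hδ] with s hs
    have hP : IsPathConnected ((fun τ : ℝ => (τ : ℂ) * φ (γ s)) '' Icc 0 1) :=
      isPathConnected_image_Icc zero_le_one (by fun_prop)
    have := hA.mem_leaf hP ?_ (c := 0) ?_ (z := 0) (w := φ (γ s)) ⟨0, by simp⟩ ⟨1, by simp⟩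
    · rwa [hsymm0, φ.left_inv (hball hs).2] at this
    · rintro _ ⟨τ, hτ, rfl⟩
      rw [ht, mem_ball_zero_iff, norm_mul, Complex.norm_of_nonneg hτ.1]
      exact (mul_le_of_le_one_left (norm_nonneg _) hτ.2).trans_lt (hnorm s hs)
    · rintro _ ⟨τ, hτ, rfl⟩
      simp only [verModel_smul τ hτ.1, hver s hs, mul_zero]
  intro s hs
  by_contra hne
  set c := verModel k (φ (γ s)) with hc
  have hcpos : 0 < c := verModel_nonneg.lt_of_ne (Ne.symm hne)
  -- the part of the path between times `t` and `s`, parametrized by `[0, 1]`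
  have hmem : ∀ τ ∈ Icc (0 : ℝ) 1, t + τ * (s - t) ∈ Metric.ball t δ := by
    intro τ hτ
    rw [Metric.mem_ball, Real.dist_eq] at hs ⊢
    rw [add_sub_cancel_left, abs_mul, abs_of_nonneg hτ.1]
    exact (mul_le_of_le_one_left (abs_nonneg _) hτ.2).trans_lt hs
  set w : ℝ → ℂ := fun τ => φ (γ (t + τ * (s - t))) with hw
  have hwc : ContinuousOn w (Icc 0 1) :=
    φ.continuousOn.comp (hγ.comp (by fun_prop)).continuousOn fun τ hτ => (hball (hmem τ hτ)).2
  have hw0 : verModel k (w 0) = 0 := by simp [hw, h0, hk]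
  have hw1 : verModel k (w 1) = c := by simp [hw, hc]
  obtain ⟨τ₀, hτ₀, hvτ₀, hgt⟩ := exists_last_time zero_le_one
    (continuous_verModel (k := k).comp_continuousOn hwc) (c := c / 2)
    (by simp only [Function.comp_apply, hw0]; linarith)
    (by simp only [Function.comp_apply, hw1]; linarith)
  have hvτ₀ : verModel k (w τ₀) = c / 2 := hvτ₀
  have hsub : Icc τ₀ 1 ⊆ Icc 0 1 := Icc_subset_Icc_left hτ₀.1
  have hpos : ∀ τ ∈ Icc τ₀ 1, 0 < verModel k (w τ) := by
    intro τ hτ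
    rcases hτ.1.eq_or_lt with h1 | h1
    · rw [← h1, hvτ₀]; linarith
    · exact (half_pos hcpos).trans (hgt τ ⟨h1, hτ.2⟩)
  obtain ⟨ξ, hξ, hwξ⟩ := exists_eq_sectorMap isPreconnected_Icc (hwc.mono hsub) hk hpos
  have hpow : ∀ x : ℝ, (ξ * sectorMap k x) ^ k = (x : ℂ) ^ 2 := fun x => by
    rw [mul_pow, hξ, one_mul, sectorMap_pow hk]
  have hhorJ : ∀ x : ℝ, horModel k (ξ * sectorMap k x) = 0 := fun x => by
    rw [horModel_of_sq (hpow x)]; simp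
  have hverJ : ∀ x : ℝ, 0 ≤ x → verModel k (ξ * sectorMap k x) = x := fun x hx => by
    rw [verModel_of_sq (hpow x)]; simpa using abs_of_nonneg hx
  have hcross : ∀ x ∈ Icc (c / 2) c, ∃ τ ∈ Icc τ₀ 1, verModel k (w τ) = x := fun x hx =>
    intermediate_value_Icc hτ₀.2.le (continuous_verModel (k := k).comp_continuousOn (hwc.mono hsub))
      (by simpa only [Function.comp_apply, hvτ₀, hw1] using hx)
  have hxmem : ∀ τ ∈ Icc (0 : ℝ) 1, c / 2 + τ * (c / 2) ∈ Icc (c / 2) c := by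
    intro τ hτ
    constructor <;> nlinarith [hτ.1, hτ.2]
  have key := hB.exists_arc hA
    (σ := fun τ : ℝ => ξ * sectorMap k ((c / 2 + τ * (c / 2) : ℝ) : ℂ)) (c := 0) ?_ ?_
    (fun τ _ => hhorJ _) ?_
  · obtain ⟨J, hJ, hJl, hJe, hJm⟩ := key
    obtain ⟨V, hV, C, hlong⟩ := exists_meas_le_of_small (B := B) h.left h.transverse
    obtain ⟨V₁, hV₁, hcomp⟩ := comp_mem_uniformity_sets hV
    obtain ⟨V₂, hV₂, hsymm, hV₂s⟩ := symm_of_uniformity hV₁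
    have hlim : Tendsto (fun n : ℕ => κ ^ n * (c / 2)) atTop atTop :=
      (tendsto_pow_atTop_atTop_of_one_lt h.one_lt).atTop_mul_const (half_pos hcpos)
    obtain ⟨n, hn1, hn2, hn3⟩ := ((hst V₁ hV₁).and ((h.eventually_mem hV₂ (Real.sqrt (R ^ k))).and
      (hlim.eventually_gt_atTop (max C 0)))).exists
    obtain ⟨h1, h2, h3⟩ := hJ.iterate h.image_right h.expand hJl n
    have hle := hlong (F^[n] (γ t)) _ _ _ h1 h2 ?_
    · rw [h3, hJm, hverJ _ (by linarith), hverJ _ (by linarith)] at hle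
      rw [show |c / 2 + 1 * (c / 2) - (c / 2 + 0 * (c / 2))| = c / 2 by
        rw [show c / 2 + 1 * (c / 2) - (c / 2 + 0 * (c / 2)) = c / 2 by ring]
        exact abs_of_pos (half_pos hcpos),
        ← ENNReal.ofReal_pow (one_pos.trans h.one_lt).le,
        ← ENNReal.ofReal_mul (pow_nonneg (one_pos.trans h.one_lt).le _)] at hle
      refine absurd hle (not_le.2 ?_)
      rw [ENNReal.ofReal_lt_ofReal_iff']
      exact ⟨(le_max_left _ _).trans_lt hn3, (le_max_right _ _).trans_lt hn3⟩
    · rw [hJe]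
      rintro _ ⟨_, ⟨_, ⟨τ, hτ, rfl⟩, rfl⟩, rfl⟩
      obtain ⟨u, hu, hux⟩ := hcross _ (hxmem τ hτ)
      have hum := hmem u (hsub hu)
      refine hcomp (SetRel.prodMk_mem_comp (hn1 (t + u * (s - t)) (hball hum).1)
        (hV₂s (hsymm.symm _ _ ?_)))
      simp only [← hux]
      have hβ : φ.symm (w u) = γ (t + u * (s - t)) := φ.left_inv (hball hum).2
      by_cases hh : horModel k (w u) = 0
      · have h4 : modelCoord k (w u) = verModel k (w u) := by
          apply Complex.ext
          · simp [modelCoord]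
          · have := abs_im_modelCoord (hpos u hu)
            rw [hh, abs_eq_zero] at this
            simpa using this
        rw [← h4, ← hwξ u hu, hβ]
        exact refl_mem_uniformity hV₂
      · obtain ⟨I, hI1, hI2, hI3⟩ := exists_arc_to_axis hk ht hA hB hξ (hnorm _ hum) (hpos u hu)
          (hwξ u hu) hh
        have := hn2 _ _ _ hI1 hI2 hI3
        rwa [hβ] at this
  · intro τ hτ
    refine ContinuousAt.continuousWithinAt (continuousAt_const.mul ?_)
    refine ContinuousAt.comp (g := sectorMap k) (continuousAt_sectorMap ?_) (by fun_prop)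
    have := (hxmem τ hτ).1
    rw [Complex.ofReal_re]; linarith
  · intro τ hτ
    obtain ⟨u, hu, hux⟩ := hcross _ (hxmem τ hτ)
    rw [ht, mem_ball_zero_iff]
    refine lt_of_le_of_lt (le_of_pow_le_pow_left₀ (n := k) (by omega) (norm_nonneg _) ?_)
      (hnorm _ (hmem u (hsub hu)))
    have h1 := horModel_sq_add_verModel_sq (k := k) (z := w u)
    have h2 := (hxmem τ hτ).1
    rw [← horModel_sq_add_verModel_sq, hverJ _ (by linarith), hhorJ, ← h1, hux]
    nlinarith [sq_nonneg (horModel k (w u))]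
  · intro u hu v hv huv
    have h1 := (hxmem u hu).1
    have h2 := (hxmem v hv).1
    simp only [hverJ _ (show 0 ≤ c / 2 + u * (c / 2) by linarith),
      hverJ _ (show 0 ≤ c / 2 + v * (c / 2) by linarith)] at huv
    exact mul_right_cancel₀ (half_pos hcpos).ne' (add_left_cancel huv)

/-- The leaves of the contracted foliation are determined by the topological dynamics. -/
theorem IsHyperbolic.mem_leaf_iff [T2Space S] [CompactSpace S] (h : IsHyperbolic F A B κ)
    {x y : S} : y ∈ A.leaf x ↔ StablyJoined F x y := by
  refine ⟨h.stablyJoined, ?_⟩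
  rintro ⟨γ, hγ, rfl, rfl, hst⟩
  have hloc : IsLocallyConstant fun t => (Quotient.mk A.sameLeaf (γ t)) := by
    rw [IsLocallyConstant.iff_eventually_eq]
    intro t
    obtain ⟨T, hT, hV⟩ := hst t
    filter_upwards [h.eventually_mem_leaf hγ hT hV] with s hs
    exact Quotient.sound (A.sameLeaf.symm hs)
  exact Quotient.exact (hloc.apply_eq_of_preconnectedSpace 0 1)

end StablyJoined

/-- A conjugacy carries the leaves of the contracted foliation to leaves of the contracted
foliation. -/
theorem IsHyperbolic.image_leaf {S S' : Type*} [TopologicalSpace S] [T2Space S] [CompactSpace S]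
    [TopologicalSpace S'] [T2Space S'] [CompactSpace S'] {F : S ≃ₜ S} {A B : PreFoliation S}
    {κ : ℝ} (hF : IsHyperbolic F A B κ) {G : S' ≃ₜ S'} {A' B' : PreFoliation S'} {κ' : ℝ}
    (hG : IsHyperbolic G A' B' κ') (h : S ≃ₜ S') (hFG : ∀ x, h (F x) = G (h x)) (x : S) :
    h '' A.leaf x = A'.leaf (h x) := by
  let _ := uniformSpaceOfCompactR1 (γ := S)
  let _ := uniformSpaceOfCompactR1 (γ := S')
  ext y
  constructor
  · rintro ⟨y, hy, rfl⟩
    exact hG.mem_leaf_iff.2 ((hF.mem_leaf_iff.1 hy).map h hFG)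
  · intro hy
    have := (hG.mem_leaf_iff.1 hy).map h.symm (G := F) (fun z => by
      rw [h.symm_apply_eq, hFG, h.apply_symm_apply])
    rw [h.symm_apply_apply] at this
    exact ⟨h.symm y, hF.mem_leaf_iff.2 this, by simp⟩


/-! ### Invariance of the number of prongs -/

section Prongs

variable {S S' : Type*} [TopologicalSpace S] [TopologicalSpace S']

/-- A homeomorphism carrying the leaf of a `k`-prong into the leaf of a `k'`-prong maps distinct
rays of the first prong to distinct rays of the second one, whence `k ≤ k'`. -/
theorem prong_le_prong {A : PreFoliation S} {A' : PreFoliation S'} (h : S ≃ₜ S') {x : S}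
    (hl : h '' A.leaf x ⊆ A'.leaf (h x)) {k k' : ℕ} (hk : 1 ≤ k) (hk' : 1 ≤ k')
    {φ : OpenPartialHomeomorph S ℂ} (hφ : IsDiscChart φ x) (hA : A.IsModelled φ (horModel k))
    {φ' : OpenPartialHomeomorph S' ℂ} (hφ' : IsDiscChart φ' (h x))
    (hA' : A'.IsModelled φ' (horModel k')) : k ≤ k' := by
  obtain ⟨hx, h0, R, hR, ht⟩ := hφ
  obtain ⟨hx', h0', R', hR', ht'⟩ := hφ'
  have hsymm0 : φ.symm 0 = x := by rw [← h0, φ.left_inv hx]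
  have h0t : (0 : ℂ) ∈ φ.target := by rw [ht]; simpa using hR
  obtain ⟨ρ₀, hρ₀, hball⟩ : ∃ ρ₀ > 0, ∀ z ∈ Metric.closedBall (0 : ℂ) ρ₀,
      z ∈ φ.target ∧ h (φ.symm z) ∈ φ'.source := by
    have h1 : φ.target ∩ φ.symm ⁻¹' (h ⁻¹' φ'.source) ∈ 𝓝 (0 : ℂ) := by
      refine inter_mem (φ.open_target.mem_nhds h0t)
        ((φ.continuousAt_symm h0t).preimage_mem_nhds
          (h.continuous.continuousAt.preimage_mem_nhds (φ'.open_source.mem_nhds ?_)))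
      rwa [hsymm0]
    obtain ⟨ρ₀, hρ₀, hsub⟩ := Metric.nhds_basis_closedBall.mem_iff.1 h1
    exact ⟨ρ₀, hρ₀, fun z hz => hsub hz⟩
  set Z := Polynomial.nthRootsFinset k (1 : ℂ) with hZ
  have hZ1 : ∀ ξ ∈ Z, ξ ^ k = 1 := fun ξ hξ => (Polynomial.mem_nthRootsFinset (by omega) 1).1 hξ
  have hZn : ∀ ξ ∈ Z, ‖ξ‖ = 1 := fun ξ hξ => norm_eq_one_of_pow hk (by simp [hZ1 ξ hξ])
  set σ : ℂ → ℝ → ℂ := fun ξ ρ => φ' (h (φ.symm (ρ * ξ))) with hσ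
  have hmem : ∀ ξ ∈ Z, ∀ ρ ∈ Icc 0 ρ₀, (ρ * ξ : ℂ) ∈ Metric.closedBall (0 : ℂ) ρ₀ := by
    intro ξ hξ ρ hρ
    rw [mem_closedBall_zero_iff, norm_mul, hZn ξ hξ, mul_one, Complex.norm_of_nonneg hρ.1]
    exact hρ.2
  have hpc : ∀ ξ ∈ Z, ContinuousOn (fun ρ : ℝ => h (φ.symm (ρ * ξ))) (Icc 0 ρ₀) := fun ξ hξ =>
    h.continuous.comp_continuousOn (φ.continuousOn_symm.comp (by fun_prop)
      fun ρ hρ => (hball _ (hmem ξ hξ ρ hρ)).1)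
  have hsrc : ∀ ξ ∈ Z, MapsTo (fun ρ : ℝ => h (φ.symm (ρ * ξ))) (Icc 0 ρ₀) φ'.source :=
    fun ξ hξ ρ hρ => (hball _ (hmem ξ hξ ρ hρ)).2
  have hσc : ∀ ξ ∈ Z, ContinuousOn (σ ξ) (Icc 0 ρ₀) := fun ξ hξ =>
    φ'.continuousOn.comp (hpc ξ hξ) (hsrc ξ hξ)
  have h0I : (0 : ℝ) ∈ Icc 0 ρ₀ := ⟨le_rfl, hρ₀.le⟩
  have hσ0 : ∀ ξ, σ ξ 0 = 0 := fun ξ => by simp [hσ, hsymm0, h0']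
  have hσinj : ∀ ξ₁ ∈ Z, ∀ ξ₂ ∈ Z, ∀ ρ₁ ∈ Icc 0 ρ₀, ∀ ρ₂ ∈ Icc 0 ρ₀, σ ξ₁ ρ₁ = σ ξ₂ ρ₂ →
      (ρ₁ * ξ₁ : ℂ) = ρ₂ * ξ₂ := by
    intro ξ₁ h₁ ξ₂ h₂ ρ₁ hρ₁ ρ₂ hρ₂ heq
    exact φ.symm.injOn (hball _ (hmem ξ₁ h₁ ρ₁ hρ₁)).1 (hball _ (hmem ξ₂ h₂ ρ₂ hρ₂)).1
      (h.injective (φ'.injOn (hsrc ξ₁ h₁ hρ₁) (hsrc ξ₂ h₂ hρ₂) heq))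
  -- the image of a ray lies in the singular leaf of the second prong
  have hhor : ∀ ξ ∈ Z, ∀ ρ ∈ Icc 0 ρ₀, horModel k' (σ ξ ρ) = 0 := by
    intro ξ hξ ρ hρ
    have hray : IsPathConnected ((fun ρ : ℝ => (ρ * ξ : ℂ)) '' Icc 0 ρ₀) :=
      isPathConnected_image_Icc hρ₀.le (by fun_prop)
    have hleaf : (fun ρ : ℝ => h (φ.symm (ρ * ξ))) '' Icc 0 ρ₀ ⊆ A'.leaf (h x) := by
      rintro _ ⟨u, hu, rfl⟩
      apply hl
      have := hA.mem_leaf hray (c := 0) (z := 0) (w := u * ξ) ?_ ?_ ⟨0, h0I, by simp⟩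
        (mem_image_of_mem _ hu)
      · rw [hsymm0] at this
        exact mem_image_of_mem h this
      · rintro _ ⟨v, hv, rfl⟩; exact (hball _ (hmem ξ hξ v hv)).1
      · rintro _ ⟨v, hv, rfl⟩
        simp only [horModel_smul v hv.1]
        rw [horModel_of_sq (ζ := 1) (by rw [hZ1 ξ hξ]; simp)]
        simp
    have := hA'.eq_of_isPathConnected (isPathConnected_image_Icc hρ₀.le (hpc ξ hξ))
      (hsrc ξ hξ).image_subset hleaf (mem_image_of_mem _ h0I) (mem_image_of_mem _ hρ)
    rw [this]
    change horModel k' (σ ξ 0) = 0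
    rw [hσ0, horModel_zero hk']
  have hpos : ∀ ξ ∈ Z, ∀ ρ ∈ Ioc 0 ρ₀, 0 < verModel k' (σ ξ ρ) := by
    intro ξ hξ ρ hρ
    have hρ' := Ioc_subset_Icc_self hρ
    refine verModel_nonneg.lt_of_ne fun hv => ?_
    have h1 := eq_zero_of_models_eq_zero (hhor ξ hξ ρ hρ') hv.symm
    rw [← hσ0 ξ] at h1
    have h2 := congrArg norm (hσinj ξ hξ ξ hξ ρ hρ' 0 h0I h1)
    rw [norm_mul, hZn ξ hξ] at h2
    simp at h2
    exact hρ.1.ne' h2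
  have hray : ∀ ξ ∈ Z, ∃ ζ : ℂ, ζ ^ k' = 1 ∧
      ∀ ρ ∈ Ioc 0 ρ₀, σ ξ ρ = ζ * sectorMap k' (verModel k' (σ ξ ρ)) := by
    intro ξ hξ
    obtain ⟨ζ, hζ, h1⟩ := exists_eq_sectorMap isPreconnected_Ioc
      ((hσc ξ hξ).mono Ioc_subset_Icc_self) hk' (hpos ξ hξ)
    refine ⟨ζ, hζ, fun ρ hρ => (h1 ρ hρ).trans ?_⟩
    congr 2
    have h2 := abs_im_modelCoord (hpos ξ hξ ρ hρ)
    rw [hhor ξ hξ ρ (Ioc_subset_Icc_self hρ), abs_eq_zero] at h2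
    apply Complex.ext
    · simp [modelCoord]
    · simpa using h2
  choose! τ hτ1 hτ2 using hray
  have hcard : ∀ n, 1 ≤ n → (Polynomial.nthRootsFinset n (1 : ℂ)).card = n := fun n hn =>
    (Complex.isPrimitiveRoot_exp n (by omega)).card_nthRootsFinset
  rw [← hcard k hk, ← hcard k' hk']
  refine Finset.card_le_card_of_injOn τ
    (fun ξ hξ => (Polynomial.mem_nthRootsFinset (by omega) 1).2 (hτ1 ξ hξ)) ?_
  -- two rays with the same image ray would have a common point at the same small height
  intro ξ₁ h₁ ξ₂ h₂ heq
  have hρ₀m : ρ₀ ∈ Ioc 0 ρ₀ := ⟨hρ₀, le_rfl⟩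
  set e := min (verModel k' (σ ξ₁ ρ₀)) (verModel k' (σ ξ₂ ρ₀)) with he
  have hepos : 0 < e := lt_min (hpos ξ₁ h₁ ρ₀ hρ₀m) (hpos ξ₂ h₂ ρ₀ hρ₀m)
  have hex : ∀ ξ ∈ Z, e ≤ verModel k' (σ ξ ρ₀) → ∃ ρ ∈ Ioc 0 ρ₀, verModel k' (σ ξ ρ) = e := by
    intro ξ hξ hle
    have hmem : e ∈ Icc (verModel k' (σ ξ 0)) (verModel k' (σ ξ ρ₀)) :=
      ⟨by simp [hσ0, hk', hepos.le], hle⟩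
    obtain ⟨ρ, hρ, hρe⟩ := intermediate_value_Icc hρ₀.le
      (continuous_verModel (k := k').comp_continuousOn (hσc ξ hξ)) hmem
    have hρe : verModel k' (σ ξ ρ) = e := hρe
    refine ⟨ρ, ⟨hρ.1.lt_of_ne ?_, hρ.2⟩, hρe⟩
    rintro rfl
    rw [hσ0, verModel_zero hk'] at hρe
    exact hepos.ne hρe
  obtain ⟨ρ₁, hρ₁, he₁⟩ := hex ξ₁ h₁ (min_le_left _ _)
  obtain ⟨ρ₂, hρ₂, he₂⟩ := hex ξ₂ h₂ (min_le_right _ _)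
  have key := hσinj ξ₁ h₁ ξ₂ h₂ ρ₁ (Ioc_subset_Icc_self hρ₁) ρ₂ (Ioc_subset_Icc_self hρ₂)
    (by rw [hτ2 ξ₁ h₁ ρ₁ hρ₁, hτ2 ξ₂ h₂ ρ₂ hρ₂, he₁, he₂, heq])
  have hn := congrArg norm key
  rw [norm_mul, norm_mul, hZn ξ₁ h₁, hZn ξ₂ h₂, mul_one, mul_one, Complex.norm_of_nonneg hρ₁.1.le,
    Complex.norm_of_nonneg hρ₂.1.le] at hn
  rw [hn] at key
  exact mul_left_cancel₀ (by exact_mod_cast hρ₂.1.ne') key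

/-- A homeomorphism which preserves the leaves of one foliation preserves the number of prongs, hence
the singularities. -/
theorem image_prongSing_subset {A B : PreFoliation S} {A' B' : PreFoliation S'} (h : S ≃ₜ S')
    (hl : ∀ x, h '' A.leaf x = A'.leaf (h x)) (ht : AreTransverse A' B') :
    h '' prongSing A B ⊆ prongSing A' B' := by
  rintro _ ⟨x, ⟨k, hk, hk2, φ, hφ, hA, -⟩, rfl⟩
  obtain ⟨k', hk', φ', hφ', hA', hB'⟩ := ht (h x)
  refine ⟨k', hk', ?_, φ', hφ', hA', hB'⟩
  have h1 := prong_le_prong h (hl x).subset hk hk' hφ hA hφ' hA'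
  have h2 := prong_le_prong h.symm (x := h x) (A := A') (A' := A)
    (by rw [← hl, ← image_comp]; simp) hk' hk hφ' hA' (by simpa using hφ) hA
  omega

end Prongs

/-! ### Transport along a conjugacy -/

section Transport

variable {S S' : Type*} [TopologicalSpace S] [TopologicalSpace S']

theorem symm_image_image (h : S ≃ₜ S') (X : Set S) : h.symm '' (h '' X) = X := by
  rw [← image_comp]; simp

theorem image_symm_image (h : S ≃ₜ S') (X : Set S') : h '' (h.symm '' X) = X := by
  rw [← image_comp]; simp

theorem image_eq_of_image_subset (h : S ≃ₜ S') {X : Set S} {Y : Set S'} (h₁ : h '' X ⊆ Y)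
    (h₂ : h.symm '' Y ⊆ X) : h '' X = Y :=
  h₁.antisymm (by rw [← image_symm_image h Y]; exact image_mono h₂)

theorem image_image_eq (h : S ≃ₜ S') {X : Set (Set S)} {Y : Set (Set S')}
    (h₁ : ∀ I ∈ X, h '' I ∈ Y) (h₂ : ∀ I ∈ Y, h.symm '' I ∈ X) : image h '' X = Y :=
  Subset.antisymm (by rintro _ ⟨I, hI, rfl⟩; exact h₁ I hI)
    fun I hI => ⟨_, h₂ I hI, image_symm_image h I⟩

theorem symm_image_image_image (h : S ≃ₜ S') (X : Set (Set S)) :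
    image h.symm '' (image h '' X) = X := by
  rw [← image_comp]
  have : image h.symm ∘ image h = id := funext fun J => symm_image_image h J
  rw [this, image_id]

theorem sUnion_image_image (h : S ≃ₜ S') (X : Set (Set S)) : ⋃₀ (image h '' X) = h '' ⋃₀ X :=
  image_sUnion.symm

theorem arcEnds_image (h : S ≃ₜ S') (J : Set S) : arcEnds (h '' J) = h '' arcEnds J := by
  refine (image_eq_of_image_subset h ?_ ?_).symm
  · rintro _ ⟨a, ⟨b, hab⟩, rfl⟩
    exact ⟨h b, hab.image h⟩
  · rintro _ ⟨a, ⟨b, hab⟩, rfl⟩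
    have := hab.image h.symm
    rw [symm_image_image] at this
    exact ⟨_, this⟩

theorem image_mem_components (h : S ≃ₜ S') {X C : Set S} (hC : C ∈ components X) :
    h '' C ∈ components (h '' X) := by
  obtain ⟨x, hx, rfl⟩ := hC
  exact ⟨h x, mem_image_of_mem h hx, h.image_connectedComponentIn hx⟩

theorem components_image (h : S ≃ₜ S') (X : Set S) :
    components (h '' X) = image h '' components X := by
  refine (image_image_eq h (fun C hC => image_mem_components h hC) fun C hC => ?_).symm
  simpa only [symm_image_image] using image_mem_components h.symm hC

/-- The homeomorphism `h` carries the leaves of `A` to the leaves of `A'`. -/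
def MapsLeaves (h : S ≃ₜ S') (A : PreFoliation S) (A' : PreFoliation S') : Prop :=
  ∀ x, h '' A.leaf x = A'.leaf (h x)

theorem MapsLeaves.symm {h : S ≃ₜ S'} {A : PreFoliation S} {A' : PreFoliation S'}
    (hA : MapsLeaves h A A') : MapsLeaves h.symm A' A := fun y => by
  obtain ⟨x, rfl⟩ := h.surjective y
  rw [← hA, symm_image_image, h.symm_apply_apply]

variable {h : S ≃ₜ S'} {A B : PreFoliation S} {A' B' : PreFoliation S'}

theorem MapsLeaves.image_subset (hA : MapsLeaves h A A') {X : Set S} {x : S} (hX : X ⊆ A.leaf x) :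
    h '' X ⊆ A'.leaf (h x) := hA x ▸ image_mono hX

theorem MapsLeaves.mem (hA : MapsLeaves h A A') {x y : S} (hy : y ∈ A.leaf x) :
    h y ∈ A'.leaf (h x) := hA x ▸ mem_image_of_mem h hy

theorem MapsLeaves.leafIn_image (hA : MapsLeaves h A A') (r : Set S) (x : S) :
    leafIn A' (h '' r) (h x) = h '' leafIn A r x := by
  rw [leafIn, leafIn, image_pathComponentIn, image_inter h.injective, hA]

theorem TriviallyBifoliated.image (hA : MapsLeaves h A A') (hB : MapsLeaves h B B') {r : Set S}
    (hr : TriviallyBifoliated A B r) : TriviallyBifoliated A' B' (h '' r) := by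
  refine ⟨h.isOpenMap r hr.isOpen, hr.connected.image h h.continuous.continuousOn, ?_, ?_, ?_⟩
  · rintro _ ⟨x, hx, rfl⟩
    obtain ⟨a, b, hab⟩ := hr.arc_left x hx
    rw [hA.leafIn_image, ← h.image_closure]
    exact ⟨_, _, hab.image h⟩
  · rintro _ ⟨x, hx, rfl⟩
    obtain ⟨a, b, hab⟩ := hr.arc_right x hx
    rw [hB.leafIn_image, ← h.image_closure]
    exact ⟨_, _, hab.image h⟩
  · rintro _ ⟨x, hx, rfl⟩ _ ⟨y, hy, rfl⟩
    obtain ⟨z, hz, hxy⟩ := hr.inter x hx y hy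
    refine ⟨h z, mem_image_of_mem h hz, ?_⟩
    rw [hA.leafIn_image, hB.leafIn_image, ← h.image_closure, ← h.image_closure,
      ← image_inter h.injective, hxy, image_singleton]

theorem IsSubrectangle.image (hA : MapsLeaves h A A') (hB : MapsLeaves h B B') {C r : Set S}
    (hC : IsSubrectangle A B C r) : IsSubrectangle A' B' (h '' C) (h '' r) := by
  refine ⟨hC.1.image hA hB, ?_, ?_⟩
  · rw [← h.image_closure, ← h.image_closure]; exact image_mono hC.2.1
  · rintro _ ⟨x, hx, rfl⟩
    rw [hA.leafIn_image, hA.leafIn_image, hC.2.2 x hx]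

theorem isOpen_openSquare : IsOpen openSquare := isOpen_Ioo.reProdIm isOpen_Ioo

theorem openSquare_subset_closedSquare : openSquare ⊆ closedSquare := fun _ hz =>
  ⟨Ioo_subset_Icc_self hz.1, Ioo_subset_Icc_self hz.2⟩

theorem IsParametrization.image [ChartedSpace ℂ S] [ChartedSpace ℂ S']
    (ho : OrientationPreserving h) (hA : MapsLeaves h A A') (hB : MapsLeaves h B B') {r : Set S}
    {ρ : ℂ → S} (hρ : IsParametrization A B r ρ) : IsParametrization A' B' (h '' r) (h ∘ ρ) where
  bifoliated := hρ.bifoliated.image hA hB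
  continuousOn := h.continuous.comp_continuousOn hρ.continuousOn
  image_closed := by rw [image_comp, hρ.image_closed, h.image_closure]
  image_open := by rw [image_comp, hρ.image_open]
  injOn_open := h.injective.comp_injOn hρ.injOn_open
  open_map U hU hUo := by rw [image_comp]; exact h.isOpenMap _ (hρ.open_map U hU hUo)
  orientation z hz := ho.comp_param (hρ.continuousOn.continuousAt
    (mem_of_superset (isOpen_openSquare.mem_nhds hz) openSquare_subset_closedSquare))
    (hρ.orientation z hz)
  horizontal z hz w hw e := hA.mem (hρ.horizontal z hz w hw e)
  horizontal_inj z hz w hw e e' := hρ.horizontal_inj z hz w hw e (h.injective e')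
  vertical z hz w hw e := hB.mem (hρ.vertical z hz w hw e)
  vertical_inj z hz w hw e e' := hρ.vertical_inj z hz w hw e (h.injective e')

theorem image_mem_generatedGraph (hA : MapsLeaves h A A') {P 𝒥 I : Set S}
    (hI : I ∈ generatedGraph A P 𝒥) : h '' I ∈ generatedGraph A' (h '' P) (h '' 𝒥) := by
  obtain ⟨p, hp, x, hx, harc, hl, hd⟩ := hI
  refine ⟨h p, mem_image_of_mem h hp, h x, mem_image_of_mem h hx, harc.image h,
    hA.image_subset hl, ?_⟩
  rw [← image_pair, ← image_sdiff h.injective, ← image_inter h.injective, hd, image_empty]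

theorem generatedGraph_image (hA : MapsLeaves h A A') (P 𝒥 : Set S) :
    generatedGraph A' (h '' P) (h '' 𝒥) = image h '' generatedGraph A P 𝒥 := by
  refine (image_image_eq h (fun I hI => image_mem_generatedGraph hA hI) fun I hI => ?_).symm
  simpa only [symm_image_image] using image_mem_generatedGraph hA.symm hI

theorem graphEnds_image (h : S ≃ₜ S') (δ : Set (Set S)) :
    graphEnds (image h '' δ) = h '' graphEnds δ := by
  ext y
  constructor
  · rintro ⟨_, ⟨I, hI, rfl⟩, hy⟩
    rw [arcEnds_image] at hy
    obtain ⟨x, hx, rfl⟩ := hy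
    exact ⟨x, ⟨I, hI, hx⟩, rfl⟩
  · rintro ⟨x, ⟨I, hI, hx⟩, rfl⟩
    exact ⟨_, mem_image_of_mem _ hI, by rw [arcEnds_image]; exact mem_image_of_mem h hx⟩

theorem regularPart_image (h : S ≃ₜ S') (δ : Set (Set S)) :
    regularPart (image h '' δ) = h '' regularPart δ := by
  rw [regularPart, regularPart, sUnion_image_image, graphEnds_image, image_sdiff h.injective]

theorem IsRegularRail.image (hB : MapsLeaves h B B') {δ : Set (Set S)} {J : Set S}
    (hJ : IsRegularRail B δ J) : IsRegularRail B' (image h '' δ) (h '' J) := by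
  obtain ⟨a, b, harc, hl, ha, hb, hd⟩ := hJ
  refine ⟨h a, h b, harc.image h, hB.image_subset hl, ?_, ?_, ?_⟩
  · rw [regularPart_image]; exact mem_image_of_mem h ha
  · rw [regularPart_image]; exact mem_image_of_mem h hb
  · rw [← image_pair, sUnion_image_image, ← image_sdiff h.injective, ← image_inter h.injective, hd,
      image_empty]

theorem verticalLeaf_comp (h : S ≃ₜ S') (ρ : ℂ → S) (s : ℝ) :
    verticalLeaf (h ∘ ρ) s = h '' verticalLeaf ρ s := image_comp _ _ _

variable [ChartedSpace ℂ S] [ChartedSpace ℂ S']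

theorem image_mem_extremeRails (ho : OrientationPreserving h) (hA : MapsLeaves h A A')
    (hB : MapsLeaves h B B') {δ : Set (Set S)} {J : Set S} (hJ : J ∈ extremeRails A B δ) :
    h '' J ∈ extremeRails A' B' (image h '' δ) := by
  obtain ⟨⟨a, b, harc, hl, ha⟩, r, ρ, hρ, hi, hδ, s₀, hs₀, hJs, hreg⟩ := hJ
  refine ⟨⟨h a, h b, harc.image h, hB.image_subset hl, ?_⟩, h '' r, h ∘ ρ, hρ.image ho hA hB,
    h.injective.comp_injOn hi, ?_, s₀, hs₀, ?_, fun s hs hne => ?_⟩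
  · rw [regularPart_image, h.injective.mem_set_image]; exact ha
  · rw [image_comp, sUnion_image_image]; exact image_mono hδ
  · rw [verticalLeaf_comp, ← hJs]
  · rw [verticalLeaf_comp]; exact (hreg s hs hne).image hB

theorem extremeRails_image (ho : OrientationPreserving h) (hA : MapsLeaves h A A')
    (hB : MapsLeaves h B B') (δ : Set (Set S)) :
    extremeRails A' B' (image h '' δ) = image h '' extremeRails A B δ := by
  refine (image_image_eq h (fun I hI => image_mem_extremeRails ho hA hB hI) fun I hI => ?_).symm
  simpa only [symm_image_image_image] using
    image_mem_extremeRails ho.symm hA.symm hB.symm hI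

/-- The homeomorphism `h` is an orientation preserving conjugacy from `f` to `g` which carries the
invariant foliations (without their measures) and the singularities of `f` to those of `g`. -/
structure IsConjugacy (f : PseudoAnosov S) (g : PseudoAnosov S') (h : S ≃ₜ S') : Prop where
  orientation : OrientationPreserving h
  conj : ∀ x, h (f.toHomeo x) = g.toHomeo (h x)
  stable : MapsLeaves h f.stable g.stable
  unstable : MapsLeaves h f.unstable g.unstable
  sing : h '' f.sing = g.sing

namespace IsConjugacy

variable {f : PseudoAnosov S} {g : PseudoAnosov S'}

theorem symm (hc : IsConjugacy f g h) : IsConjugacy g f h.symm where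
  orientation := hc.orientation.symm
  conj y := by rw [h.symm_apply_eq, hc.conj, h.apply_symm_apply]
  stable := hc.stable.symm
  unstable := hc.unstable.symm
  sing := by rw [← hc.sing, symm_image_image]

theorem mem_sing (hc : IsConjugacy f g h) {x : S} : h x ∈ g.sing ↔ x ∈ f.sing := by
  rw [← hc.sing, h.injective.mem_set_image]

theorem iterate (hc : IsConjugacy f g h) (n : ℕ) (x : S) :
    h (f.toHomeo^[n] x) = g.toHomeo^[n] (h x) :=
  (show Function.Semiconj h f.toHomeo g.toHomeo from hc.conj).iterate_right n x

theorem isFirstIntersection (hc : IsConjugacy f g h) {z : S} (hz : f.IsFirstIntersection z) :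
    g.IsFirstIntersection (h z) := by
  obtain ⟨hzs, p, hp, q, hq, I, J, hI, hIl, hJ, hJl, hIJ⟩ := hz
  refine ⟨mt hc.mem_sing.1 hzs, h p, hc.mem_sing.2 hp, h q, hc.mem_sing.2 hq, h '' I, h '' J,
    hI.image h, hc.stable.image_subset hIl, hJ.image h, hc.unstable.image_subset hJl, ?_⟩
  rw [← image_singleton, ← image_singleton, ← image_sdiff h.injective, ← image_sdiff h.injective,
    ← image_inter h.injective, hIJ, image_singleton]

theorem image_primitiveSegment_subset (hc : IsConjugacy f g h) (z : S) :
    h '' f.primitiveSegment z ⊆ g.primitiveSegment (h z) := by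
  rintro _ ⟨x, ⟨J, ⟨q, hq, hJ, hl⟩, hx⟩, rfl⟩
  exact ⟨h '' J, ⟨h q, hc.mem_sing.2 hq, hJ.image h, hc.unstable.image_subset hl⟩,
    mem_image_of_mem h hx⟩

theorem primitiveSegment (hc : IsConjugacy f g h) (z : S) :
    g.primitiveSegment (h z) = h '' f.primitiveSegment z :=
  (image_eq_of_image_subset h (hc.image_primitiveSegment_subset z)
    (by simpa using hc.symm.image_primitiveSegment_subset (h z))).symm

theorem segmentOrbit (hc : IsConjugacy f g h) (z : S) :
    g.segmentOrbit (h z) = h '' f.segmentOrbit z := by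
  ext y
  obtain ⟨x, rfl⟩ := h.surjective y
  rw [h.injective.mem_set_image]
  simp only [PseudoAnosov.segmentOrbit, mem_ofPred_eq, hc.primitiveSegment, ← hc.iterate,
    h.injective.mem_set_image]

theorem sGraph (hc : IsConjugacy f g h) (z : S) : g.sGraph (h z) = image h '' f.sGraph z := by
  rw [PseudoAnosov.sGraph, hc.segmentOrbit, ← hc.sing, generatedGraph_image hc.stable,
    PseudoAnosov.sGraph]

theorem uGraph (hc : IsConjugacy f g h) (z : S) : g.uGraph (h z) = image h '' f.uGraph z := by
  rw [PseudoAnosov.uGraph, hc.sGraph, sUnion_image_image, ← hc.sing,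
    generatedGraph_image hc.unstable, PseudoAnosov.uGraph]

theorem uGraphIter (hc : IsConjugacy f g h) (z : S) (n : ℕ) :
    g.uGraphIter (h z) n = image h '' f.uGraphIter z n := by
  rw [PseudoAnosov.uGraphIter, hc.uGraph, PseudoAnosov.uGraphIter, image_image, image_image]
  refine image_congr fun J _ => ?_
  rw [image_image, image_image]
  exact image_congr fun x _ => (hc.iterate n x).symm

theorem compatible (hc : IsConjugacy f g h) {δs δu : Set (Set S)} (hδ : f.Compatible δs δu) :
    g.Compatible (image h '' δs) (image h '' δu) := by
  obtain ⟨h1, h2, h3, h4⟩ := hδ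
  refine ⟨?_, ?_, ?_, ?_⟩
  · rw [graphEnds_image, sUnion_image_image]; exact image_mono h1
  · rw [graphEnds_image, sUnion_image_image]; exact image_mono h2
  · rw [extremeRails_image hc.orientation hc.stable hc.unstable, sUnion_image_image]
    rintro _ ⟨J, hJ, rfl⟩
    exact image_mono (h3 J hJ)
  · rw [extremeRails_image hc.orientation hc.unstable hc.stable, sUnion_image_image]
    rintro _ ⟨J, hJ, rfl⟩
    exact image_mono (h4 J hJ)

theorem compatible_iff (hc : IsConjugacy f g h) {δs δu : Set (Set S)} :
    g.Compatible (image h '' δs) (image h '' δu) ↔ f.Compatible δs δu :=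
  ⟨fun hδ => by simpa only [symm_image_image_image] using hc.symm.compatible hδ, hc.compatible⟩

theorem compatibilityCoefficient (hc : IsConjugacy f g h) (z : S) :
    g.compatibilityCoefficient (h z) = f.compatibilityCoefficient z := by
  simp only [PseudoAnosov.compatibilityCoefficient, hc.sGraph, hc.uGraphIter, hc.compatible_iff]

theorem compatibilityOrder (hc : IsConjugacy f g h) :
    f.compatibilityOrder = g.compatibilityOrder := by
  rw [PseudoAnosov.compatibilityOrder, PseudoAnosov.compatibilityOrder]
  congr 1
  ext N
  constructor
  · rintro ⟨z, hz, rfl⟩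
    exact ⟨h z, hc.isFirstIntersection hz, (hc.compatibilityCoefficient z).symm⟩
  · rintro ⟨z, hz, rfl⟩
    exact ⟨h.symm z, hc.symm.isFirstIntersection hz, (hc.symm.compatibilityCoefficient z).symm⟩

theorem primitiveInteriors (hc : IsConjugacy f g h) (z : S) (n : ℕ) :
    g.primitiveInteriors (h z) n = image h '' f.primitiveInteriors z n := by
  rw [PseudoAnosov.primitiveInteriors, hc.sGraph, hc.uGraphIter, sUnion_image_image,
    sUnion_image_image, ← image_union, ← image_compl_eq h.bijective, components_image,
    PseudoAnosov.primitiveInteriors]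

theorem preimage_toHomeo (hc : IsConjugacy f g h) (X : Set S) :
    g.toHomeo ⁻¹' (h '' X) = h '' (f.toHomeo ⁻¹' X) := by
  ext y
  obtain ⟨x, rfl⟩ := h.surjective y
  rw [mem_preimage, ← hc.conj, h.injective.mem_set_image, h.injective.mem_set_image, mem_preimage]

theorem image_toHomeo (hc : IsConjugacy f g h) (X : Set S) :
    g.toHomeo '' (h '' X) = h '' (f.toHomeo '' X) := by
  rw [image_image, image_image]
  exact image_congr fun x _ => (hc.conj x).symm

/-- The image of a geometric Markov partition under a conjugacy. -/
def mapPartition (hc : IsConjugacy f g h) {n : ℕ} (R : GeometricMarkovPartition f n) :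
    GeometricMarkovPartition g n where
  int i := h '' R.int i
  param i := h ∘ R.param i
  isParam i := (R.isParam i).image hc.orientation hc.stable hc.unstable
  cover := by
    simp only [← h.image_closure, ← image_iUnion, R.cover, image_univ, h.range_coe]
  disjoint i j hij := (disjoint_image_iff h.injective).2 (R.disjoint i j hij)
  horizontal i j := by
    rw [hc.preimage_toHomeo, ← image_inter h.injective, components_image]
    rintro _ ⟨C, hC, rfl⟩
    exact (R.horizontal i j C hC).image hc.stable hc.unstable
  vertical i j := by
    rw [hc.image_toHomeo, ← image_inter h.injective, components_image]
    rintro _ ⟨C, hC, rfl⟩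
    exact (R.vertical i j C hC).image hc.unstable hc.stable

variable {n : ℕ} (R : GeometricMarkovPartition f n)

theorem horizontals_mapPartition (hc : IsConjugacy f g h) (i : Fin n) :
    (hc.mapPartition R).horizontals i = image h '' R.horizontals i := by
  simp only [GeometricMarkovPartition.horizontals, mapPartition, hc.preimage_toHomeo, ← image_iUnion,
    ← image_inter h.injective, components_image]

theorem verticals_mapPartition (hc : IsConjugacy f g h) (k : Fin n) :
    (hc.mapPartition R).verticals k = image h '' R.verticals k := by
  simp only [GeometricMarkovPartition.verticals, mapPartition, hc.image_toHomeo, ← image_iUnion,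
    ← image_inter h.injective, components_image]

theorem preservesVertical_iff (hc : IsConjugacy f g h) (i k : Fin n) (H : Set S) :
    (hc.mapPartition R).PreservesVertical i k (h '' H) ↔ R.PreservesVertical i k H := by
  simp only [GeometricMarkovPartition.PreservesVertical, mapPartition, Function.comp_apply,
    h.injective.mem_set_image, ← hc.conj, h.injective.eq_iff]

theorem hasGeometricType (hc : IsConjugacy f g h) {T : GeometricType}
    {R : GeometricMarkovPartition f T.n} (hT : HasGeometricType T R) :
    HasGeometricType T (hc.mapPartition R) := by
  obtain ⟨H, V, hH, hV, hHV, hsign⟩ := hT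
  refine ⟨fun i j => h '' H i j, fun k l => h '' V k l, fun i => ⟨?_, ?_⟩, fun k => ⟨?_, ?_⟩,
    fun i j => ?_, fun i j => ?_⟩
  · rw [hc.horizontals_mapPartition, ← (hH i).1, ← range_comp]; rfl
  · intro j j' hjj' z hz w hw hzj hwj
    exact (hH i).2 j j' hjj' z hz w hw (h.injective.mem_set_image.1 hzj)
      (h.injective.mem_set_image.1 hwj)
  · rw [hc.verticals_mapPartition, ← (hV k).1, ← range_comp]; rfl
  · intro l l' hll' z hz w hw hzl hwl
    exact (hV k).2 l l' hll' z hz w hw (h.injective.mem_set_image.1 hzl)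
      (h.injective.mem_set_image.1 hwl)
  · rw [hc.image_toHomeo, hHV]
  · rw [hc.preservesVertical_iff, hsign]

theorem primitiveTypes_subset (hc : IsConjugacy f g h) (m : ℕ) :
    f.primitiveTypes m ⊆ g.primitiveTypes m := by
  rintro T ⟨z, hz, R, hi, hr, hT⟩
  refine ⟨h z, hc.isFirstIntersection hz, hc.mapPartition R, h.injective.image_injective.comp hi, ?_,
    hc.hasGeometricType hT⟩
  rw [hc.primitiveInteriors, ← hr, ← range_comp]; rfl

theorem primitiveTypes (hc : IsConjugacy f g h) (m : ℕ) :
    f.primitiveTypes m = g.primitiveTypes m :=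
  (hc.primitiveTypes_subset m).antisymm (hc.symm.primitiveTypes_subset m)

end IsConjugacy

/-- A topological conjugacy carries the foliations to each other, since their leaves are determined
by the dynamics, and hence also the singularities. -/
theorem isConjugacy_of_conj [OrientedSurface S] [OrientedSurface S'] {f : PseudoAnosov S}
    {g : PseudoAnosov S'} (ho : OrientationPreserving h)
    (hconj : ∀ x, h (f.toHomeo x) = g.toHomeo (h x))
    (hmarked : prongSing f.stable f.unstable = ∅ → h '' f.sing = g.sing) : IsConjugacy f g h := by
  have := OrientedSurface.compact (S := S)
  have := OrientedSurface.compact (S := S')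
  have := OrientedSurface.hausdorff (S := S)
  have := OrientedSurface.hausdorff (S := S')
  have hs : MapsLeaves h f.stable g.stable := f.isHyperbolic.image_leaf g.isHyperbolic h hconj
  have hu : MapsLeaves h f.unstable g.unstable :=
    f.isHyperbolic.symm.image_leaf g.isHyperbolic.symm h fun x => by
      rw [g.toHomeo.eq_symm_apply, ← hconj, f.toHomeo.apply_symm_apply]
  refine ⟨ho, hconj, hs, hu, ?_⟩
  rcases (prongSing f.stable f.unstable).eq_empty_or_nonempty with he | hne
  · exact hmarked he
  · have heq : h '' prongSing f.stable f.unstable = prongSing g.stable g.unstable :=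
      image_eq_of_image_subset h (image_prongSing_subset h hs g.transverse)
        (image_prongSing_subset h.symm hs.symm f.transverse)
    rw [f.sing_eq hne, g.sing_eq (heq ▸ hne.image h), heq]

end Transport
end PA

end

theorem mainTheorem11 {S S' : Type*}
    [TopologicalSpace S] [ChartedSpace ℂ S] [PA.OrientedSurface S]
    [TopologicalSpace S'] [ChartedSpace ℂ S'] [PA.OrientedSurface S']
    (f : PA.PseudoAnosov S) (g : PA.PseudoAnosov S')
    (h : S ≃ₜ S') (h_orientation : PA.OrientationPreserving h)
    (h_conj : ∀ x, h (f.toHomeo x) = g.toHomeo (h x))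
    (h_marked : PA.prongSing f.stable f.unstable = ∅ → h '' f.sing = g.sing) :
    f.compatibilityOrder = g.compatibilityOrder ∧
    (∀ m ≥ f.compatibilityOrder, f.primitiveTypes m = g.primitiveTypes m) ∧
    f.canonicalTypes = g.canonicalTypes := by
  have hc := PA.isConjugacy_of_conj h_orientation h_conj h_marked
  refine ⟨hc.compatibilityOrder, fun m _ => hc.primitiveTypes m, ?_⟩
  rw [PA.PseudoAnosov.canonicalTypes, hc.compatibilityOrder, hc.primitiveTypes,
    PA.PseudoAnosov.canonicalTypes]
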